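/- Let $\mathcal S$ be a field. The $\mathcal L^{\mathcal S}$-calculus is the following calculus. Its propositions are $A ::= \top \mid \bot \mid A\Rightarrow A\mid A\wedge A\mid A\vee A$. Its proof-terms, taken modulo $\alpha$-equivalence, are $$t ::= x \mid t \boxplus u \mid a\bullet t\mid a.\star\mid \delta_\top(t,u)\mid\delta_\bot(t)\mid\lambda x.t\mid t\,u\mid\langle t,u\rangle\mid\delta^1_\wedge(t,x.u)\mid\delta^2_\wedge(t,x.u)\mid \mathrm{inl}(t)\mid \mathrm{inr}(t)\mid\delta_\vee(t,x.u,y.v)\qquad(a\in\mathcal S).$$ The typing rules are those of linear natural deduction, with scalars and with a sum and a product rule. A comma denotes the disjoint union of contexts, which are finite. - $x:A\vdash x:A$, and $\vdash a.\star:\top$. - If $\Gamma\vdash t:A$ and $\Gamma\vdash u:A$, then $\Gamma\vdash t\boxplus u:A$. If $\Gamma\vdash t:A$, then $\Gamma\vdash a\bullet t:A$. - If $\Gamma\vdash t:\top$ and $\Delta\vdash u:A$, then $\Gamma,\Delta\vdash\delta_\top(t,u):A$. If $\Gamma\vdash t:\bot$, then $\Gamma,\Delta\vdash\delta_\bot(t):C$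 for every $\Delta$. - If $\Gamma,x:A\vdash t:B$, then $\Gamma\vdash\lambda x.t:A\Rightarrow B$. If $\Gamma\vdash t:A\Rightarrow B$ and $\Delta\vdash u:A$, then $\Gamma,\Delta\vdash t\,u:B$. - If $\Gamma\vdash t:A$ and $\Gamma\vdash u:B$, then $\Gamma\vdash\langle t,u\rangle:A\wedge B$. If $\Gamma\vdash t:A_1\wedge A_2$ and $\Delta,x:A_i\vdash u:C$, then $\Gamma,\Delta\vdash\delta^i_\wedge(t,x.u):C$ ($i=1,2$). - If $\Gamma\vdash t:A$, then $\Gamma\vdash\mathrm{inl}(t):A\vee B$. If $\Gamma\vdash t:B$, then $\Gamma\vdash\mathrm{inr}(t):A\vee B$. If $\Gamma\vdash t:A\vee B$, $\Delta,x:A\vdash u:C$ and $\Delta,y:B\vdash v:C$, then $\Gamma,\Delta\vdash\delta_\vee(t,x.u,y.v):C$. The reduction $\longrightarrow$ is generated by the following rules, applied anywhere in a term, where $(u/x)t$ is the substitution of $u$ for $x$ in $t$: $$\begin{array}{ll} \delta_\top(a.\star,t)\to a\bullet t, & (\lambda x.t)\,u\to(u/x)t,\\ \delta^1_\wedge(\langle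 t,u\rangle,x.v)\to(t/x)v, & \delta^2_\wedge(\langle t,u\rangle,x.v)\to(u/x)v,\\ \delta_\vee(\mathrm{inl}(t),x.v,y.w)\to(t/x)v, & \delta_\vee(\mathrm{inr}(u),x.v,y.w)\to(u/y)w,\\ a.\star\boxplus b.\star\to(a+b).\star, & a\bullet b.\star\to(ab).\star,\\ \lambda x.t\boxplus\lambda x.u\to\lambda x.(t\boxplus u), & a\bullet\lambda x.t\to\lambda x.(a\bullet t),\\ \langle t,u\rangle\boxplus\langle v,w\rangle\to\langle t\boxplus v,u\boxplus w\rangle, & a\bullet\langle t,u\rangle\to\langle a\bullet t,a\bullet u\rangle,\\ \delta_\vee(t\boxplus u,x.v,y.w)\to\delta_\vee(t,x.v,y.w)\boxplus\delta_\vee(u,x.v,y.w), & \delta_\vee(a\bullet t,x.v,y.w)\to a\bullet\delta_\vee(t,x.v,y.w). \end{array}$$ A closed proof of $A$ is a term $t$ with $\vdash t:A$ in the empty context. An irreducible form of $t$ is an irreducible term to which $t$ reduces in finitely many steps. Let $\mathcal V$ be the set of propositions built from $\top$ with $\wedge$, and let $d(A)$ be the number of occurrences of $\top$ in $A\in\mathcal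 V$. A vector ${\bf u}\in\mathcal S^{d(A)}$ is encoded by the irreducible closed proof $\overline{\bf u}^A$ of $A$ defined by $\overline{(a)}^\top=a.\star$ and $\overline{({\bf u}_1,{\bf u}_2)}^{A_1\wedge A_2}=\langle\overline{{\bf u}_1}^{A_1},\overline{{\bf u}_2}^{A_2}\rangle$, where ${\bf u}_i\in\mathcal S^{d(A_i)}$. Conversely, $\underline{t}\in\mathcal S^{d(A)}$ denotes the vector read off from the irreducible form of a closed proof $t$ of $A$, by $\underline{a.\star}=(a)$ and $\underline{\langle t_1,t_2\rangle}=(\underline{t_1},\underline{t_2})$. 1. Let $A,B\in\mathcal V$ with $d(A)=m$ and $d(B)=n$, and let $t$ be a closed proof of $A\Rightarrow B$. Then the function $F:\mathcal S^m\to\mathcal S^n$, $F({\bf u})=\underline{t~\overline{\bf u}^A}$, is well defined: for every ${\bf u}$, the term $t~\overline{\bf u}^A$ has exactly one irreducible form, and this form is $\overline{F({\bf u})}^B$. Moreover $F$ is $\mathcal S$-linear. 2. Consequently cloning is not expressible: there is no closed proof $t$ of $(\top\wedge\top)\Rightarrow((\top\wedge\top)\wedge(\top\wedge\top))$ such that the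 function $F:\mathcal S^2\to\mathcal S^4$ of part 1 satisfies $F(a,b)=(a^2,ab,ab,b^2)$ for all $a,b\in\mathcal S$. -/

import Mathlib

namespace LS

universe u

/-- The propositions `⊤`, `⊥`, `A ⇒ B`, `A ∧ B`, `A ∨ B`. -/
inductive Proposition : Type
  | top : Proposition
  | bot : Proposition
  | imp : Proposition → Proposition → Proposition
  | conj : Proposition → Proposition → Proposition
  | disj : Proposition → Proposition → Proposition

/-- Proof-terms modulo α-equivalence, in de Bruijn form: `Tm S n` is the type of the proof-terms
whose free variables are among `n` given ones. A binder binds the variable `0` of its body, and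
`Tm S 0` is the type of the closed proof-terms. -/
inductive Tm (S : Type u) : ℕ → Type u
  /-- `x` -/
  | var {n : ℕ} (i : Fin n) : Tm S n
  /-- `t + u` (the interstitial rule sum) -/
  | plus {n : ℕ} (t u : Tm S n) : Tm S n
  /-- `a • t` (the interstitial rule prod) -/
  | scal {n : ℕ} (a : S) (t : Tm S n) : Tm S n
  /-- `a.⋆` -/
  | star {n : ℕ} (a : S) : Tm S n
  /-- `δ_⊤(t, u)` -/
  | elimTop {n : ℕ} (t u : Tm S n) : Tm S n
  /-- `δ_⊥(t)` -/
  | elimBot {n : ℕ} (t : Tm S n) : Tm S n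
  /-- `λ x. t` -/
  | lam {n : ℕ} (t : Tm S (n + 1)) : Tm S n
  /-- `t u` -/
  | app {n : ℕ} (t u : Tm S n) : Tm S n
  /-- `⟨t, u⟩` -/
  | pair {n : ℕ} (t u : Tm S n) : Tm S n
  /-- `δ_∧¹(t, x. u)` -/
  | elimConj₁ {n : ℕ} (t : Tm S n) (u : Tm S (n + 1)) : Tm S n
  /-- `δ_∧²(t, x. u)` -/
  | elimConj₂ {n : ℕ} (t : Tm S n) (u : Tm S (n + 1)) : Tm S n
  /-- `inl(t)` -/
  | inl {n : ℕ} (t : Tm S n) : Tm S n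
  /-- `inr(t)` -/
  | inr {n : ℕ} (t : Tm S n) : Tm S n
  /-- `δ_∨(t, x. u, y. v)` -/
  | elimDisj {n : ℕ} (t : Tm S n) (u v : Tm S (n + 1)) : Tm S n

namespace Tm

variable {S : Type u}

/-- Extension of a renaming below a binder. -/
def upRen {m n : ℕ} (ρ : Fin m → Fin n) : Fin (m + 1) → Fin (n + 1) :=
  Fin.cases 0 (fun i => (ρ i).succ)

/-- Renaming of the free variables. -/
def rename : {m n : ℕ} → (Fin m → Fin n) → Tm S m → Tm S n
  | _, _, ρ, var i => var (ρ i)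
  | _, _, ρ, plus t u => plus (rename ρ t) (rename ρ u)
  | _, _, ρ, scal a t => scal a (rename ρ t)
  | _, _, _, star a => star a
  | _, _, ρ, elimTop t u => elimTop (rename ρ t) (rename ρ u)
  | _, _, ρ, elimBot t => elimBot (rename ρ t)
  | _, _, ρ, lam t => lam (rename (upRen ρ) t)
  | _, _, ρ, app t u => app (rename ρ t) (rename ρ u)
  | _, _, ρ, pair t u => pair (rename ρ t) (rename ρ u)
  | _, _, ρ, elimConj₁ t u => elimConj₁ (rename ρ t) (rename (upRen ρ) u)
  | _, _, ρ, elimConj₂ t u => elimConj₂ (rename ρ t) (rename (upRen ρ) u)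
  | _, _, ρ, inl t => inl (rename ρ t)
  | _, _, ρ, inr t => inr (rename ρ t)
  | _, _, ρ, elimDisj t u v =>
      elimDisj (rename ρ t) (rename (upRen ρ) u) (rename (upRen ρ) v)

/-- Extension of a substitution below a binder. -/
def upSubst {m n : ℕ} (σ : Fin m → Tm S n) : Fin (m + 1) → Tm S (n + 1) :=
  Fin.cases (var 0) (fun i => rename Fin.succ (σ i))

/-- Simultaneous capture-avoiding substitution. -/
def subst : {m n : ℕ} → (Fin m → Tm S n) → Tm S m → Tm S n
  | _, _, σ, var i => σ i
  | _, _, σ, plus t u => plus (subst σ t) (subst σ u)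
  | _, _, σ, scal a t => scal a (subst σ t)
  | _, _, _, star a => star a
  | _, _, σ, elimTop t u => elimTop (subst σ t) (subst σ u)
  | _, _, σ, elimBot t => elimBot (subst σ t)
  | _, _, σ, lam t => lam (subst (upSubst σ) t)
  | _, _, σ, app t u => app (subst σ t) (subst σ u)
  | _, _, σ, pair t u => pair (subst σ t) (subst σ u)
  | _, _, σ, elimConj₁ t u => elimConj₁ (subst σ t) (subst (upSubst σ) u)
  | _, _, σ, elimConj₂ t u => elimConj₂ (subst σ t) (subst (upSubst σ) u)
  | _, _, σ, inl t => inl (subst σ t)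
  | _, _, σ, inr t => inr (subst σ t)
  | _, _, σ, elimDisj t u v =>
      elimDisj (subst σ t) (subst (upSubst σ) u) (subst (upSubst σ) v)

/-- `t.inst u` is `(u/x)t`, where `x` is the variable `0` of `t`. -/
def inst {n : ℕ} (t : Tm S (n + 1)) (u : Tm S n) : Tm S n :=
  subst (Fin.cases u var) t

end Tm

/-- A context assigns a proposition to some of the `n` variables; the variable `i` is declared in
`Γ` when `Γ i ≠ none`. -/
abbrev Ctx (n : ℕ) : Type := Fin n → Option Proposition

/-- The context `Γ, x : A`, where `x` is the new variable `0`. -/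
def Ctx.ext {n : ℕ} (Γ : Ctx n) (A : Proposition) : Ctx (n + 1) := Fin.cons (some A) Γ

/-- `Γ.Splits Γ₁ Γ₂`: the context `Γ` is `Γ₁, Γ₂`, that is, the disjoint union of the two. -/
def Ctx.Splits {n : ℕ} (Γ Γ₁ Γ₂ : Ctx n) : Prop :=
  ∀ i, (Γ₁ i = Γ i ∧ Γ₂ i = none) ∨ (Γ₁ i = none ∧ Γ₂ i = Γ i)

/-- The typing relation `Γ ⊢ t : A`, given by the deduction rules. -/
inductive HasType {S : Type u} : {n : ℕ} → Ctx n → Tm S n → Proposition → Prop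
  | ax {n : ℕ} {Γ : Ctx n} {i : Fin n} {A : Proposition} :
      Γ i = some A → (∀ j, j ≠ i → Γ j = none) → HasType Γ (.var i) A
  | sum {n : ℕ} {Γ : Ctx n} {t u : Tm S n} {A : Proposition} :
      HasType Γ t A → HasType Γ u A → HasType Γ (.plus t u) A
  | prod {n : ℕ} {Γ : Ctx n} {a : S} {t : Tm S n} {A : Proposition} :
      HasType Γ t A → HasType Γ (.scal a t) A
  | topI {n : ℕ} {Γ : Ctx n} {a : S} :
      (∀ j, Γ j = none) → HasType Γ (.star a) .top
  | topE {n : ℕ} {Γ Γ₁ Γ₂ : Ctx n} {t u : Tm S n} {A : Proposition} :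
      Γ.Splits Γ₁ Γ₂ → HasType Γ₁ t .top → HasType Γ₂ u A → HasType Γ (.elimTop t u) A
  | botE {n : ℕ} {Γ Γ₁ Γ₂ : Ctx n} {t : Tm S n} {C : Proposition} :
      Γ.Splits Γ₁ Γ₂ → HasType Γ₁ t .bot → HasType Γ (.elimBot t) C
  | impI {n : ℕ} {Γ : Ctx n} {t : Tm S (n + 1)} {A B : Proposition} :
      HasType (Γ.ext A) t B → HasType Γ (.lam t) (.imp A B)
  | impE {n : ℕ} {Γ Γ₁ Γ₂ : Ctx n} {t u : Tm S n} {A B : Proposition} :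
      Γ.Splits Γ₁ Γ₂ → HasType Γ₁ t (.imp A B) → HasType Γ₂ u A → HasType Γ (.app t u) B
  | conjI {n : ℕ} {Γ : Ctx n} {t u : Tm S n} {A B : Proposition} :
      HasType Γ t A → HasType Γ u B → HasType Γ (.pair t u) (.conj A B)
  | conjE₁ {n : ℕ} {Γ Γ₁ Γ₂ : Ctx n} {t : Tm S n} {u : Tm S (n + 1)} {A B C : Proposition} :
      Γ.Splits Γ₁ Γ₂ → HasType Γ₁ t (.conj A B) → HasType (Γ₂.ext A) u C →
      HasType Γ (.elimConj₁ t u) C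
  | conjE₂ {n : ℕ} {Γ Γ₁ Γ₂ : Ctx n} {t : Tm S n} {u : Tm S (n + 1)} {A B C : Proposition} :
      Γ.Splits Γ₁ Γ₂ → HasType Γ₁ t (.conj A B) → HasType (Γ₂.ext B) u C →
      HasType Γ (.elimConj₂ t u) C
  | disjI₁ {n : ℕ} {Γ : Ctx n} {t : Tm S n} {A B : Proposition} :
      HasType Γ t A → HasType Γ (.inl t) (.disj A B)
  | disjI₂ {n : ℕ} {Γ : Ctx n} {t : Tm S n} {A B : Proposition} :
      HasType Γ t B → HasType Γ (.inr t) (.disj A B)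
  | disjE {n : ℕ} {Γ Γ₁ Γ₂ : Ctx n} {t : Tm S n} {u v : Tm S (n + 1)} {A B C : Proposition} :
      Γ.Splits Γ₁ Γ₂ → HasType Γ₁ t (.disj A B) →
      HasType (Γ₂.ext A) u C → HasType (Γ₂.ext B) v C →
      HasType Γ (.elimDisj t u v) C

/-- `t` is a closed proof of `A`, that is, `⊢ t : A` in the empty context. -/
def IsClosedProof {S : Type u} (t : Tm S 0) (A : Proposition) : Prop :=
  HasType (fun _ => none) t A

/-- One-step reduction: the fourteen reduction rules, applied anywhere in a proof-term. -/
inductive Step {S : Type u} [Field S] : {n : ℕ} → Tm S n → Tm S n → Prop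
  -- cut reductions
  | topBeta {n : ℕ} (a : S) (t : Tm S n) : Step (.elimTop (.star a) t) (.scal a t)
  | beta {n : ℕ} (t : Tm S (n + 1)) (u : Tm S n) : Step (.app (.lam t) u) (t.inst u)
  | conjBeta₁ {n : ℕ} (t u : Tm S n) (v : Tm S (n + 1)) :
      Step (.elimConj₁ (.pair t u) v) (v.inst t)
  | conjBeta₂ {n : ℕ} (t u : Tm S n) (v : Tm S (n + 1)) :
      Step (.elimConj₂ (.pair t u) v) (v.inst u)
  | disjBeta₁ {n : ℕ} (t : Tm S n) (v w : Tm S (n + 1)) :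
      Step (.elimDisj (.inl t) v w) (v.inst t)
  | disjBeta₂ {n : ℕ} (u : Tm S n) (v w : Tm S (n + 1)) :
      Step (.elimDisj (.inr u) v w) (w.inst u)
  -- commutation of sum
  | plusStar {n : ℕ} (a b : S) :
      Step (n := n) (.plus (.star a) (.star b)) (.star (a + b))
  | plusLam {n : ℕ} (t u : Tm S (n + 1)) :
      Step (.plus (.lam t) (.lam u)) (.lam (.plus t u))
  | plusPair {n : ℕ} (t u v w : Tm S n) :
      Step (.plus (.pair t u) (.pair v w)) (.pair (.plus t v) (.plus u w))
  | disjPlus {n : ℕ} (t u : Tm S n) (v w : Tm S (n + 1)) :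
      Step (.elimDisj (.plus t u) v w) (.plus (.elimDisj t v w) (.elimDisj u v w))
  -- commutation of prod
  | scalStar {n : ℕ} (a b : S) :
      Step (n := n) (.scal a (.star b)) (.star (a * b))
  | scalLam {n : ℕ} (a : S) (t : Tm S (n + 1)) :
      Step (.scal a (.lam t)) (.lam (.scal a t))
  | scalPair {n : ℕ} (a : S) (t u : Tm S n) :
      Step (.scal a (.pair t u)) (.pair (.scal a t) (.scal a u))
  | disjScal {n : ℕ} (a : S) (t : Tm S n) (v w : Tm S (n + 1)) :
      Step (.elimDisj (.scal a t) v w) (.scal a (.elimDisj t v w))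
  -- closure under contexts
  | plusL {n : ℕ} {t t' : Tm S n} (u : Tm S n) : Step t t' → Step (.plus t u) (.plus t' u)
  | plusR {n : ℕ} (t : Tm S n) {u u' : Tm S n} : Step u u' → Step (.plus t u) (.plus t u')
  | scalC {n : ℕ} (a : S) {t t' : Tm S n} : Step t t' → Step (.scal a t) (.scal a t')
  | elimTopL {n : ℕ} {t t' : Tm S n} (u : Tm S n) :
      Step t t' → Step (.elimTop t u) (.elimTop t' u)
  | elimTopR {n : ℕ} (t : Tm S n) {u u' : Tm S n} :
      Step u u' → Step (.elimTop t u) (.elimTop t u')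
  | elimBotC {n : ℕ} {t t' : Tm S n} : Step t t' → Step (.elimBot t) (.elimBot t')
  | lamC {n : ℕ} {t t' : Tm S (n + 1)} : Step t t' → Step (.lam t) (.lam t')
  | appL {n : ℕ} {t t' : Tm S n} (u : Tm S n) : Step t t' → Step (.app t u) (.app t' u)
  | appR {n : ℕ} (t : Tm S n) {u u' : Tm S n} : Step u u' → Step (.app t u) (.app t u')
  | pairL {n : ℕ} {t t' : Tm S n} (u : Tm S n) : Step t t' → Step (.pair t u) (.pair t' u)
  | pairR {n : ℕ} (t : Tm S n) {u u' : Tm S n} : Step u u' → Step (.pair t u) (.pair t u')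
  | elimConj₁L {n : ℕ} {t t' : Tm S n} (u : Tm S (n + 1)) :
      Step t t' → Step (.elimConj₁ t u) (.elimConj₁ t' u)
  | elimConj₁R {n : ℕ} (t : Tm S n) {u u' : Tm S (n + 1)} :
      Step u u' → Step (.elimConj₁ t u) (.elimConj₁ t u')
  | elimConj₂L {n : ℕ} {t t' : Tm S n} (u : Tm S (n + 1)) :
      Step t t' → Step (.elimConj₂ t u) (.elimConj₂ t' u)
  | elimConj₂R {n : ℕ} (t : Tm S n) {u u' : Tm S (n + 1)} :
      Step u u' → Step (.elimConj₂ t u) (.elimConj₂ t u')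
  | inlC {n : ℕ} {t t' : Tm S n} : Step t t' → Step (.inl t) (.inl t')
  | inrC {n : ℕ} {t t' : Tm S n} : Step t t' → Step (.inr t) (.inr t')
  | elimDisjL {n : ℕ} {t t' : Tm S n} (u v : Tm S (n + 1)) :
      Step t t' → Step (.elimDisj t u v) (.elimDisj t' u v)
  | elimDisjM {n : ℕ} (t : Tm S n) {u u' : Tm S (n + 1)} (v : Tm S (n + 1)) :
      Step u u' → Step (.elimDisj t u v) (.elimDisj t u' v)
  | elimDisjR {n : ℕ} (t : Tm S n) (u : Tm S (n + 1)) {v v' : Tm S (n + 1)} :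
      Step v v' → Step (.elimDisj t u v) (.elimDisj t u v')

/-- `v` is an irreducible form of `t`: the term `t` reduces to `v` in finitely many steps, and `v`
is irreducible. -/
def IsNormalFormOf {S : Type u} [Field S] {n : ℕ} (v t : Tm S n) : Prop :=
  Relation.ReflTransGen Step t v ∧ ∀ w, ¬ Step v w

open Classical in
/-- The irreducible form of `t` (and `t` itself if there is none). -/
noncomputable def normalForm {S : Type u} [Field S] {n : ℕ} (t : Tm S n) : Tm S n :=
  if h : ∃ v, IsNormalFormOf v t then h.choose else t

/-- The set `𝒱` of the propositions built from `⊤` with `∧`. -/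
inductive VProp : Type
  | top : VProp
  | conj : VProp → VProp → VProp

/-- A member of `𝒱`, as a proposition. -/
def VProp.toProposition : VProp → Proposition
  | .top => .top
  | .conj A B => .conj A.toProposition B.toProposition

/-- The dimension `d(A)`: the number of occurrences of `⊤` in `A`. -/
def VProp.dim : VProp → ℕ
  | .top => 1
  | .conj A B => A.dim + B.dim

/-- The closed irreducible proof of `A` that encodes a vector of `𝒮^d(A)`: a proposition `A₁ ∧ A₂`
cuts the vector into its first `d(A₁)` and its last `d(A₂)` coordinates. -/
def encode {S : Type u} : (A : VProp) → (Fin A.dim → S) → Tm S 0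
  | .top, x => .star (x (0 : Fin 1))
  | .conj A B, x =>
      .pair (encode A (fun i => x (Fin.castAdd B.dim i)))
        (encode B (fun i => x (Fin.natAdd A.dim i)))

/-- The scalar `a` of a proof-term `a.⋆` (and `0` for a proof-term of any other shape). -/
def Tm.scalar {S : Type u} [Field S] {n : ℕ} : Tm S n → S
  | .star a => a
  | _ => 0

/-- The first component `t` of `⟨t, u⟩` (and the proof-term itself if it is not a pair). -/
def Tm.fst {S : Type u} {n : ℕ} : Tm S n → Tm S n
  | .pair t _ => t
  | t => t

/-- The second component `u` of `⟨t, u⟩` (and the proof-term itself if it is not a pair). -/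
def Tm.snd {S : Type u} {n : ℕ} : Tm S n → Tm S n
  | .pair _ u => u
  | t => t

/-- The vector of a closed irreducible proof of `A`, which has the form `a.⋆` if `A = ⊤` and the
form `⟨t, u⟩` if `A = A₁ ∧ A₂`: the scalar `a`, or the vectors of `t` and `u` as two blocks. -/
def decode {S : Type u} [Field S] : (A : VProp) → Tm S 0 → (Fin A.dim → S)
  | .top, t => fun _ => t.scalar
  | .conj A B, t => Fin.append (decode A t.fst) (decode B t.snd)

/-- The vector of a closed proof of `A`: the vector of its irreducible form. -/
noncomputable def vectorOf {S : Type u} [Field S] (A : VProp) (t : Tm S 0) : Fin A.dim → S :=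
  decode A (normalForm t)

/-- The function `x ↦` (vector of `t` applied to the encoding of `x`) from `𝒮^d(A)` to
`𝒮^d(B)`. -/
noncomputable def applyVec {S : Type u} [Field S] (A B : VProp) (t : Tm S 0) :
    (Fin A.dim → S) → (Fin B.dim → S) :=
  fun x => vectorOf B (.app t (encode A x))

end LS

namespace LS

universe u

open Relation

/-! ### Algebra of renaming and substitution -/

namespace Tm

variable {S : Type u}

/-! A closed proof of `A ⇒ B` denotes a matrix, and applying it to an encoded vector computes a
matrix product. Propositions are interpreted by finite-dimensional coordinate spaces: `⊤` by the
scalars, `⊥` by zero, `⇒` by matrices, and both `∧` and `∨` by direct sums. A typing derivation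
denotes a function of the environment. Since each declared variable is consumed once, up to the
additive sharing of contexts and the zero denotation of `δ_⊥`, this function is linear in each
declared variable separately (`Den.map_comb`).

Linearity makes reduction preserve denotations (`Den.step`): it justifies β, because a matrix
remembers a function only through its values on basis vectors; it justifies the commutation of `δ_∨`
with sums and scalars; and it makes the branch not taken by `δ_∨`, evaluated at `0`, vanish.

A reducibility argument (`HasType.red`) shows that every closed proof of a proposition of `𝒱`
reduces to some encoded vector. Neither confluence nor strong normalization is needed. An
irreducible form is again a closed proof, so it reduces to an encoding; being irreducible, it is
that encoding, whose coordinates are fixed by the preserved denotation (`Den.isNormalFormOf_iff`).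
Linearity of `F` is then linearity of the product with a fixed matrix, and cloning fails because
`ab` is not additive. -/

theorem upRen_comp {l m n : ℕ} (ρ : Fin l → Fin m) (τ : Fin m → Fin n) :
    (fun i => upRen τ (upRen ρ i)) = upRen (fun i => τ (ρ i)) := by
  funext i
  cases i using Fin.cases <;> rfl

theorem rename_rename {l m n : ℕ} (ρ : Fin l → Fin m) (τ : Fin m → Fin n) (t : Tm S l) :
    rename τ (rename ρ t) = rename (fun i => τ (ρ i)) t := by
  induction t generalizing m n <;> simp_all [rename, upRen_comp]

theorem upSubst_upRen {l m n : ℕ} (ρ : Fin l → Fin m) (τ : Fin m → Tm S n) :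
    (fun i => upSubst τ (upRen ρ i)) = upSubst (fun i => τ (ρ i)) := by
  funext i
  cases i using Fin.cases <;> rfl

theorem subst_rename {l m n : ℕ} (ρ : Fin l → Fin m) (τ : Fin m → Tm S n) (t : Tm S l) :
    subst τ (rename ρ t) = subst (fun i => τ (ρ i)) t := by
  induction t generalizing m n <;> simp_all [rename, subst, upSubst_upRen]

theorem rename_upSubst {l m n : ℕ} (σ : Fin l → Tm S m) (τ : Fin m → Fin n) :
    (fun i => rename (upRen τ) (upSubst σ i)) = upSubst (fun i => rename τ (σ i)) := by
  funext i
  cases i using Fin.cases with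
  | zero => rfl
  | succ i =>
    change rename (upRen τ) (rename Fin.succ (σ i)) = rename Fin.succ (rename τ (σ i))
    rw [rename_rename, rename_rename]
    rfl

theorem rename_subst {l m n : ℕ} (σ : Fin l → Tm S m) (τ : Fin m → Fin n) (t : Tm S l) :
    rename τ (subst σ t) = subst (fun i => rename τ (σ i)) t := by
  induction t generalizing m n <;> simp_all [rename, subst, rename_upSubst]

theorem subst_upSubst {l m n : ℕ} (σ : Fin l → Tm S m) (τ : Fin m → Tm S n) :
    (fun i => subst (upSubst τ) (upSubst σ i)) = upSubst (fun i => subst τ (σ i)) := by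
  funext i
  cases i using Fin.cases with
  | zero => rfl
  | succ i =>
    change subst (upSubst τ) (rename Fin.succ (σ i)) = rename Fin.succ (subst τ (σ i))
    rw [subst_rename, rename_subst]
    rfl

/-- Passing under a binder shifts the substituted terms by a renaming, so the binder case rests on
both mixed laws, `subst_rename` and `rename_subst`. -/
theorem subst_subst {l m n : ℕ} (σ : Fin l → Tm S m) (τ : Fin m → Tm S n) (t : Tm S l) :
    subst τ (subst σ t) = subst (fun i => subst τ (σ i)) t := by
  induction t generalizing m n <;> simp_all [subst, subst_upSubst]

theorem upSubst_var {n : ℕ} : upSubst (var : Fin n → Tm S n) = var := by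
  funext i
  cases i using Fin.cases <;> rfl

theorem subst_var {n : ℕ} (t : Tm S n) : subst var t = t := by
  induction t <;> simp_all [subst, upSubst_var]

/-- Links the two forms in which a body occurs: reduction instantiates an already substituted body,
while inductions on typing use one substitution extended at variable `0`. -/
theorem inst_subst_upSubst {m n : ℕ} (σ : Fin m → Tm S n) (t : Tm S (m + 1)) (u : Tm S n) :
    (subst (upSubst σ) t).inst u = subst (Fin.cases u σ) t := by
  rw [inst, subst_subst]
  congr 1
  funext i
  cases i using Fin.cases with
  | zero => rfl
  | succ i =>
    change subst (Fin.cases u var) (rename Fin.succ (σ i)) = σ i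
    rw [subst_rename]
    exact subst_var _

end Tm

/-! ### Weak normalization -/

section Normalization

variable {S : Type u} [Field S]

theorem Step.lift {m n : ℕ} {F : Tm S m → Tm S n} (hF : ∀ t t', Step t t' → Step (F t) (F t'))
    {t t' : Tm S m} (h : ReflTransGen Step t t') : ReflTransGen Step (F t) (F t') := by
  induction h with
  | refl => exact .refl
  | tail _ h ih => exact ih.tail (hF _ _ h)

/-- The terms that reduce to a linear combination of injections of members of `P` and `Q`. -/
inductive SumRed (P Q : Tm S 0 → Prop) : Tm S 0 → Prop
  | inl {t u : Tm S 0} : ReflTransGen Step t (.inl u) → P u → SumRed P Q t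
  | inr {t u : Tm S 0} : ReflTransGen Step t (.inr u) → Q u → SumRed P Q t
  | plus {t u v : Tm S 0} :
      ReflTransGen Step t (.plus u v) → SumRed P Q u → SumRed P Q v → SumRed P Q t
  | scal {t u : Tm S 0} (a : S) :
      ReflTransGen Step t (.scal a u) → SumRed P Q u → SumRed P Q t

/-- The reducible closed terms of each proposition. -/
def Red : Proposition → Tm S 0 → Prop
  | .top, t => ∃ a, ReflTransGen Step t (.star a)
  | .bot, _ => False
  | .imp A B, t => ∃ t', ReflTransGen Step t (.lam t') ∧ ∀ u, Red A u → Red B (t'.inst u)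
  | .conj A B, t => ∃ u v, ReflTransGen Step t (.pair u v) ∧ Red A u ∧ Red B v
  | .disj A B, t => SumRed (Red A) (Red B) t

/-- Reducibility only asks for some reduction to a suitable shape, so prefixing a reduction is
harmless. This yields weak normalization only, which suffices. -/
theorem Red.expand {A : Proposition} {t t' : Tm S 0} (h : ReflTransGen Step t t')
    (ht : Red A t') : Red A t := by
  cases A with
  | top => exact ht.imp fun a => h.trans
  | bot => exact ht
  | imp A B => exact ht.imp fun _ => And.imp_left h.trans
  | conj A B => exact ht.imp fun _ => Exists.imp fun _ => And.imp_left h.trans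
  | disj A B =>
    cases ht with
    | inl h' hu => exact .inl (h.trans h') hu
    | inr h' hu => exact .inr (h.trans h') hu
    | plus h' hu hv => exact .plus (h.trans h') hu hv
    | scal a h' hu => exact .scal a (h.trans h') hu

/-- Sums commute with the introductions of `⊤`, `⇒` and `∧`, which drives the induction. They do not
commute with `inl` and `inr`; this is why reducibility at a disjunction admits formal linear
combinations. -/
theorem Red.plus {A : Proposition} {t u : Tm S 0} (ht : Red A t) (hu : Red A u) :
    Red A (.plus t u) := by
  induction A generalizing t u with
  | top =>
    obtain ⟨a, ha⟩ := ht
    obtain ⟨b, hb⟩ := hu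
    exact ⟨a + b, ((Step.lift (fun _ _ => .plusL u) ha).trans
      (Step.lift (fun _ _ => .plusR _) hb)).tail (.plusStar a b)⟩
  | bot => exact ht
  | imp A B _ ihB =>
    obtain ⟨t', ha, hat⟩ := ht
    obtain ⟨u', hb, hbu⟩ := hu
    exact ⟨.plus t' u', ((Step.lift (fun _ _ => .plusL u) ha).trans
      (Step.lift (fun _ _ => .plusR _) hb)).tail (.plusLam _ _),
      fun w hw => ihB (hat w hw) (hbu w hw)⟩
  | conj A B ihA ihB =>
    obtain ⟨t₁, t₂, ha, h₁, h₂⟩ := ht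
    obtain ⟨u₁, u₂, hb, k₁, k₂⟩ := hu
    exact ⟨.plus t₁ u₁, .plus t₂ u₂, ((Step.lift (fun _ _ => .plusL u) ha).trans
      (Step.lift (fun _ _ => .plusR _) hb)).tail (.plusPair _ _ _ _), ihA h₁ k₁, ihB h₂ k₂⟩
  | disj A B => exact SumRed.plus .refl ht hu

theorem Red.scal {A : Proposition} (a : S) {t : Tm S 0} (ht : Red A t) :
    Red A (.scal a t) := by
  induction A generalizing t with
  | top =>
    obtain ⟨b, hb⟩ := ht
    exact ⟨a * b, (Step.lift (fun _ _ => .scalC a) hb).tail (.scalStar a b)⟩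
  | bot => exact ht
  | imp A B _ ihB =>
    obtain ⟨t', ha, hat⟩ := ht
    exact ⟨.scal a t', (Step.lift (fun _ _ => .scalC a) ha).tail (.scalLam _ _),
      fun w hw => ihB (hat w hw)⟩
  | conj A B ihA ihB =>
    obtain ⟨t₁, t₂, ha, h₁, h₂⟩ := ht
    exact ⟨.scal a t₁, .scal a t₂,
      (Step.lift (fun _ _ => .scalC a) ha).tail (.scalPair _ _ _), ihA h₁, ihB h₂⟩
  | disj A B => exact SumRed.scal a .refl ht

/-- Induction on the formal combination: `δ_∨` commutes with its sums and scalars until it meets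
injections, where a branch is taken. -/
theorem Red.elimDisj {A B C : Proposition} {t : Tm S 0} {v w : Tm S 1}
    (ht : SumRed (Red A) (Red B) t) (hv : ∀ u, Red A u → Red C (v.inst u))
    (hw : ∀ u, Red B u → Red C (w.inst u)) : Red C (.elimDisj t v w) := by
  induction ht with
  | inl h hu =>
    exact (hv _ hu).expand ((Step.lift (fun _ _ => .elimDisjL v w) h).tail (.disjBeta₁ _ _ _))
  | inr h hu =>
    exact (hw _ hu).expand ((Step.lift (fun _ _ => .elimDisjL v w) h).tail (.disjBeta₂ _ _ _))
  | plus h _ _ ih₁ ih₂ =>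
    exact (ih₁.plus ih₂).expand
      ((Step.lift (fun _ _ => .elimDisjL v w) h).tail (.disjPlus _ _ _ _))
  | scal a h _ ih =>
    exact (ih.scal a).expand
      ((Step.lift (fun _ _ => .elimDisjL v w) h).tail (.disjScal _ _ _ _))

/-- `σ` maps the variables declared in `Γ` to reducible terms. -/
def RedSubst {n : ℕ} (Γ : Ctx n) (σ : Fin n → Tm S 0) : Prop :=
  ∀ i A, Γ i = some A → Red A (σ i)

theorem Ctx.Splits.left {n : ℕ} {Γ Γ₁ Γ₂ : Ctx n} (h : Γ.Splits Γ₁ Γ₂) {i : Fin n}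
    {A : Proposition} (hi : Γ₁ i = some A) : Γ i = some A := by
  rcases h i with h | h <;> simp_all

theorem Ctx.Splits.symm {n : ℕ} {Γ Γ₁ Γ₂ : Ctx n} (h : Γ.Splits Γ₁ Γ₂) : Γ.Splits Γ₂ Γ₁ :=
  fun i => (h i).symm.imp And.symm And.symm

theorem Ctx.Splits.right {n : ℕ} {Γ Γ₁ Γ₂ : Ctx n} (h : Γ.Splits Γ₁ Γ₂) {i : Fin n}
    {A : Proposition} (hi : Γ₂ i = some A) : Γ i = some A :=
  h.symm.left hi

theorem RedSubst.left {n : ℕ} {Γ Γ₁ Γ₂ : Ctx n} {σ : Fin n → Tm S 0} (h : RedSubst Γ σ)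
    (hs : Γ.Splits Γ₁ Γ₂) : RedSubst Γ₁ σ := fun i A hi => h i A (hs.left hi)

theorem RedSubst.right {n : ℕ} {Γ Γ₁ Γ₂ : Ctx n} {σ : Fin n → Tm S 0} (h : RedSubst Γ σ)
    (hs : Γ.Splits Γ₁ Γ₂) : RedSubst Γ₂ σ := fun i A hi => h i A (hs.right hi)

theorem RedSubst.ext {n : ℕ} {Γ : Ctx n} {σ : Fin n → Tm S 0} (h : RedSubst Γ σ)
    {A : Proposition} {u : Tm S 0} (hu : Red A u) :
    RedSubst (Γ.ext A) (Fin.cases u σ : Fin (n + 1) → Tm S 0) := by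
  intro i B hi
  cases i using Fin.cases with
  | zero => cases hi; exact hu
  | succ i => exact h i B hi

/-- The fundamental lemma of reducibility. Contexts matter only through inclusion of each part in
the whole; the case of `δ_⊥` is void because nothing is reducible at `⊥`. -/
theorem HasType.red {n : ℕ} {Γ : Ctx n} {t : Tm S n} {A : Proposition} (h : HasType Γ t A)
    {σ : Fin n → Tm S 0} (hσ : RedSubst Γ σ) : Red A (t.subst σ) := by
  induction h with
  | ax hi _ => exact hσ _ _ hi
  | sum _ _ ih₁ ih₂ => exact (ih₁ hσ).plus (ih₂ hσ)
  | prod _ ih => exact (ih hσ).scal _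
  | topI _ => exact ⟨_, .refl⟩
  | topE hs _ _ ih₁ ih₂ =>
    obtain ⟨a, ha⟩ := ih₁ (hσ.left hs)
    exact ((ih₂ (hσ.right hs)).scal a).expand
      ((Step.lift (fun _ _ => .elimTopL _) ha).tail (.topBeta _ _))
  | botE hs _ ih => exact (ih (hσ.left hs)).elim
  | impI _ ih =>
    refine ⟨_, .refl, fun u hu => ?_⟩
    rw [Tm.inst_subst_upSubst]
    exact ih (hσ.ext hu)
  | impE hs _ _ ih₁ ih₂ =>
    obtain ⟨t', ht, h⟩ := ih₁ (hσ.left hs)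
    exact (h _ (ih₂ (hσ.right hs))).expand
      ((Step.lift (fun _ _ => .appL _) ht).tail (.beta _ _))
  | conjI _ _ ih₁ ih₂ => exact ⟨_, _, .refl, ih₁ hσ, ih₂ hσ⟩
  | conjE₁ hs _ _ ih₁ ih₂ =>
    obtain ⟨u, v, ht, hu, hv⟩ := ih₁ (hσ.left hs)
    have := ih₂ ((hσ.right hs).ext hu)
    rw [← Tm.inst_subst_upSubst] at this
    exact this.expand ((Step.lift (fun _ _ => .elimConj₁L _) ht).tail (.conjBeta₁ _ _ _))
  | conjE₂ hs _ _ ih₁ ih₂ =>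
    obtain ⟨u, v, ht, hu, hv⟩ := ih₁ (hσ.left hs)
    have := ih₂ ((hσ.right hs).ext hv)
    rw [← Tm.inst_subst_upSubst] at this
    exact this.expand ((Step.lift (fun _ _ => .elimConj₂L _) ht).tail (.conjBeta₂ _ _ _))
  | disjI₁ _ ih => exact .inl .refl (ih hσ)
  | disjI₂ _ ih => exact .inr .refl (ih hσ)
  | disjE hs _ _ _ ih₁ ih₂ ih₃ =>
    refine Red.elimDisj (ih₁ (hσ.left hs)) (fun u hu => ?_) (fun u hu => ?_)
    · rw [Tm.inst_subst_upSubst]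
      exact ih₂ ((hσ.right hs).ext hu)
    · rw [Tm.inst_subst_upSubst]
      exact ih₃ ((hσ.right hs).ext hu)

theorem IsClosedProof.red {t : Tm S 0} {A : Proposition} (h : IsClosedProof t A) : Red A t := by
  -- With no variables, the identity substitution is vacuously reducible.
  have := HasType.red h (σ := Tm.var) (fun i => i.elim0)
  rwa [Tm.subst_var] at this

theorem Red.exists_encode {A : VProp} {t : Tm S 0} (h : Red A.toProposition t) :
    ∃ x, ReflTransGen Step t (encode A x) := by
  induction A generalizing t with
  | top =>
    obtain ⟨a, ha⟩ := h
    exact ⟨fun _ => a, ha⟩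
  | conj A B ihA ihB =>
    obtain ⟨u, v, ht, hu, hv⟩ := h
    obtain ⟨x, hx⟩ := ihA hu
    obtain ⟨y, hy⟩ := ihB hv
    refine ⟨Fin.append x y, ht.trans ?_⟩
    simp only [encode, Fin.append_left, Fin.append_right]
    exact (Step.lift (fun _ _ => .pairL v) hx).trans (Step.lift (fun _ _ => .pairR _) hy)

theorem not_step_encode (A : VProp) (x : Fin A.dim → S) (w : Tm S 0) :
    ¬ Step (encode A x) w := by
  induction A generalizing w with
  | top => rintro ⟨⟩
  | conj A B ihA ihB =>
    intro h
    cases h with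
    | pairL _ h => exact ihA _ _ h
    | pairR _ h => exact ihB _ _ h

theorem decode_encode (A : VProp) (x : Fin A.dim → S) : decode A (encode A x) = x := by
  induction A with
  | top =>
    funext i
    exact congrArg x (Subsingleton.elim (α := Fin 1) _ _)
  | conj A B ihA ihB =>
    simp only [encode, decode, Tm.fst, Tm.snd, ihA, ihB]
    exact Fin.append_castAdd_natAdd

theorem eq_of_reflTransGen_of_irreducible {n : ℕ} {t v : Tm S n} (h : ReflTransGen Step t v)
    (ht : ∀ w, ¬ Step t w) : t = v := by
  rcases h.cases_head with h | ⟨w, hw, _⟩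
  · exact h
  · exact (ht w hw).elim

end Normalization

/-! ### Matrix semantics -/

/-- The index set of a basis of the interpretation of a proposition. -/
def Idx : Proposition → Type
  | .top => Unit
  | .bot => Empty
  | .imp A B => Idx A × Idx B
  | .conj A B => Idx A ⊕ Idx B
  | .disj A B => Idx A ⊕ Idx B

noncomputable instance instFintypeIdx : (A : Proposition) → Fintype (Idx A)
  | .top => inferInstanceAs (Fintype Unit)
  | .bot => inferInstanceAs (Fintype Empty)
  | .imp A B =>
    have := instFintypeIdx A
    have := instFintypeIdx B
    inferInstanceAs (Fintype (Idx A × Idx B))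
  | .conj A B =>
    have := instFintypeIdx A
    have := instFintypeIdx B
    inferInstanceAs (Fintype (Idx A ⊕ Idx B))
  | .disj A B =>
    have := instFintypeIdx A
    have := instFintypeIdx B
    inferInstanceAs (Fintype (Idx A ⊕ Idx B))

/-- The interpretation of a proposition, a free module of finite rank. -/
abbrev Sem (S : Type u) (A : Proposition) : Type u := Idx A → S

/-- An environment gives each variable a value in the interpretation of every proposition; only
the value at its declared proposition matters. -/
abbrev Env (S : Type u) (n : ℕ) : Type u := Fin n → (A : Proposition) → Sem S A

section Semantics

variable {S : Type u} [Field S]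

open Classical in
/-- The environment `e, x` where the new variable `0` has the value `x`. -/
noncomputable def Env.ext {n : ℕ} (e : Env S n) {A : Proposition} (x : Sem S A) :
    Env S (n + 1) :=
  Fin.cons (Function.update 0 A x) e

/-- At propositions other than `A` the new variable has the junk value `0`, which no derivation
reads. -/
theorem Env.ext_zero {n : ℕ} (e : Env S n) {A : Proposition} (x : Sem S A) : e.ext x 0 A = x := by
  simp [Env.ext]

open Classical in
/-- The matrix of a linear function. -/
noncomputable def Sem.lam {A B : Proposition} (g : Sem S A → Sem S B) : Sem S (.imp A B) :=
  fun p : Idx A × Idx B => g (Pi.single p.1 1) p.2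

/-- The image of a basis vector under a matrix. -/
def Sem.row {A B : Proposition} (f : Sem S (.imp A B)) (a : Idx A) : Sem S B :=
  fun b => f ((a, b) : Idx A × Idx B)

/-- The product of a matrix and a vector. -/
noncomputable def Sem.app {A B : Proposition} (f : Sem S (.imp A B)) (x : Sem S A) : Sem S B :=
  ∑ a, x a • f.row a

theorem Sem.app_lam {A B : Proposition} {g : Sem S A → Sem S B} (hg : IsLinearMap S g)
    (x : Sem S A) : Sem.app (Sem.lam g) x = g x := by
  classical
  -- Expand `x` in the standard basis; linearity of `g` turns this into a combination of the rows of
  -- its matrix.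
  have := (hg.mk' g).pi_apply_eq_sum_univ x
  rw [IsLinearMap.mk'_apply] at this
  rw [this]
  refine Finset.sum_congr rfl fun a _ => ?_
  congr 1
  funext b
  change g _ b = g _ b
  congr 2
  funext j
  simp [Pi.single_apply, eq_comm]

theorem Sem.app_combination_left {A B : Proposition} (a b : S) (f g : Sem S (.imp A B))
    (x : Sem S A) : Sem.app (a • f + b • g) x = a • Sem.app f x + b • Sem.app g x := by
  simp only [Sem.app, Finset.smul_sum, ← Finset.sum_add_distrib]
  refine Finset.sum_congr rfl fun i _ => ?_
  change x i • (a • f.row i + b • g.row i) = _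
  module

theorem Sem.app_combination_right {A B : Proposition} (a b : S) (f : Sem S (.imp A B))
    (x y : Sem S A) : Sem.app f (a • x + b • y) = a • Sem.app f x + b • Sem.app f y := by
  simp only [Sem.app, Finset.smul_sum, ← Finset.sum_add_distrib]
  refine Finset.sum_congr rfl fun i _ => ?_
  simp only [Pi.add_apply, Pi.smul_apply, smul_eq_mul, add_smul, mul_smul]

/-- The coordinate of a vector in the interpretation of `⊤`. -/
def Sem.coord (x : Sem S .top) : S := x ()

/-- The vector with the given coordinate in the interpretation of `⊤`. -/
def Sem.ofCoord (a : S) : Sem S .top := fun _ => a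

/-- The pair of two vectors, in the interpretation of a conjunction. -/
def Sem.pair {A B : Proposition} (x : Sem S A) (y : Sem S B) : Sem S (.conj A B) :=
  Sum.elim x y

/-- The pair of two vectors, in the interpretation of a disjunction. -/
def Sem.copair {A B : Proposition} (x : Sem S A) (y : Sem S B) : Sem S (.disj A B) :=
  Sum.elim x y

/-- The first component of a pair. -/
def Sem.fst {A B : Proposition} (x : Sem S (.conj A B)) : Sem S A :=
  fun i => x (Sum.inl i : Idx A ⊕ Idx B)

/-- The second component of a pair. -/
def Sem.snd {A B : Proposition} (x : Sem S (.conj A B)) : Sem S B :=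
  fun i => x (Sum.inr i : Idx A ⊕ Idx B)

/-- The component of a disjunction at its left member. -/
def Sem.left {A B : Proposition} (x : Sem S (.disj A B)) : Sem S A :=
  fun i => x (Sum.inl i : Idx A ⊕ Idx B)

/-- The component of a disjunction at its right member. -/
def Sem.right {A B : Proposition} (x : Sem S (.disj A B)) : Sem S B :=
  fun i => x (Sum.inr i : Idx A ⊕ Idx B)

/-- `Den Γ t A f`: the term `t` has a typing derivation of `Γ ⊢ t : A` with the
denotation `f`. -/
inductive Den : {n : ℕ} → Ctx n → Tm S n → (A : Proposition) → (Env S n → Sem S A) → Prop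
  | ax {n : ℕ} {Γ : Ctx n} {i : Fin n} {A : Proposition} :
      Γ i = some A → (∀ j, j ≠ i → Γ j = none) → Den Γ (.var i) A (fun e => e i A)
  | sum {n : ℕ} {Γ : Ctx n} {t u : Tm S n} {A : Proposition} {f g : Env S n → Sem S A} :
      Den Γ t A f → Den Γ u A g → Den Γ (.plus t u) A (fun e => f e + g e)
  | prod {n : ℕ} {Γ : Ctx n} {a : S} {t : Tm S n} {A : Proposition} {f : Env S n → Sem S A} :
      Den Γ t A f → Den Γ (.scal a t) A (fun e => a • f e)
  | topI {n : ℕ} {Γ : Ctx n} {a : S} :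
      (∀ j, Γ j = none) → Den Γ (.star a) .top (fun _ => Sem.ofCoord a)
  | topE {n : ℕ} {Γ Γ₁ Γ₂ : Ctx n} {t u : Tm S n} {A : Proposition}
      {f : Env S n → Sem S .top} {g : Env S n → Sem S A} :
      Γ.Splits Γ₁ Γ₂ → Den Γ₁ t .top f → Den Γ₂ u A g →
      Den Γ (.elimTop t u) A (fun e => (f e).coord • g e)
  | botE {n : ℕ} {Γ Γ₁ Γ₂ : Ctx n} {t : Tm S n} {C : Proposition} {f : Env S n → Sem S .bot} :
      Γ.Splits Γ₁ Γ₂ → Den Γ₁ t .bot f → Den Γ (.elimBot t) C (fun _ => 0)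
  | impI {n : ℕ} {Γ : Ctx n} {t : Tm S (n + 1)} {A B : Proposition}
      {f : Env S (n + 1) → Sem S B} :
      Den (Γ.ext A) t B f → Den Γ (.lam t) (.imp A B) (fun e => Sem.lam fun x => f (e.ext x))
  | impE {n : ℕ} {Γ Γ₁ Γ₂ : Ctx n} {t u : Tm S n} {A B : Proposition}
      {f : Env S n → Sem S (.imp A B)} {g : Env S n → Sem S A} :
      Γ.Splits Γ₁ Γ₂ → Den Γ₁ t (.imp A B) f → Den Γ₂ u A g →
      Den Γ (.app t u) B (fun e => Sem.app (f e) (g e))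
  | conjI {n : ℕ} {Γ : Ctx n} {t u : Tm S n} {A B : Proposition}
      {f : Env S n → Sem S A} {g : Env S n → Sem S B} :
      Den Γ t A f → Den Γ u B g → Den Γ (.pair t u) (.conj A B) (fun e => Sem.pair (f e) (g e))
  | conjE₁ {n : ℕ} {Γ Γ₁ Γ₂ : Ctx n} {t : Tm S n} {u : Tm S (n + 1)} {A B C : Proposition}
      {f : Env S n → Sem S (.conj A B)} {g : Env S (n + 1) → Sem S C} :
      Γ.Splits Γ₁ Γ₂ → Den Γ₁ t (.conj A B) f → Den (Γ₂.ext A) u C g →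
      Den Γ (.elimConj₁ t u) C (fun e => g (e.ext (f e).fst))
  | conjE₂ {n : ℕ} {Γ Γ₁ Γ₂ : Ctx n} {t : Tm S n} {u : Tm S (n + 1)} {A B C : Proposition}
      {f : Env S n → Sem S (.conj A B)} {g : Env S (n + 1) → Sem S C} :
      Γ.Splits Γ₁ Γ₂ → Den Γ₁ t (.conj A B) f → Den (Γ₂.ext B) u C g →
      Den Γ (.elimConj₂ t u) C (fun e => g (e.ext (f e).snd))
  | disjI₁ {n : ℕ} {Γ : Ctx n} {t : Tm S n} {A B : Proposition} {f : Env S n → Sem S A} :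
      Den Γ t A f → Den Γ (.inl t) (.disj A B) (fun e => Sem.copair (f e) 0)
  | disjI₂ {n : ℕ} {Γ : Ctx n} {t : Tm S n} {A B : Proposition} {f : Env S n → Sem S B} :
      Den Γ t B f → Den Γ (.inr t) (.disj A B) (fun e => Sem.copair 0 (f e))
  | disjE {n : ℕ} {Γ Γ₁ Γ₂ : Ctx n} {t : Tm S n} {u v : Tm S (n + 1)} {A B C : Proposition}
      {f : Env S n → Sem S (.disj A B)} {g h : Env S (n + 1) → Sem S C} :
      Γ.Splits Γ₁ Γ₂ → Den Γ₁ t (.disj A B) f →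
      Den (Γ₂.ext A) u C g → Den (Γ₂.ext B) v C h →
      Den Γ (.elimDisj t u v) C (fun e => g (e.ext (f e).left) + h (e.ext (f e).right))

/-- Terms carry no type annotations, so a denotation belongs to a derivation rather than to a term.
A relation records it, and its uniqueness is never used. -/
theorem HasType.exists_den {n : ℕ} {Γ : Ctx n} {t : Tm S n} {A : Proposition}
    (h : HasType Γ t A) : ∃ f, Den Γ t A f := by
  induction h with
  | ax h₁ h₂ => exact ⟨_, .ax h₁ h₂⟩
  | sum _ _ ih₁ ih₂ => exact ⟨_, .sum ih₁.choose_spec ih₂.choose_spec⟩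
  | prod _ ih => exact ⟨_, .prod ih.choose_spec⟩
  | topI h => exact ⟨_, .topI h⟩
  | topE hs _ _ ih₁ ih₂ => exact ⟨_, .topE hs ih₁.choose_spec ih₂.choose_spec⟩
  | botE hs _ ih => exact ⟨_, .botE hs ih.choose_spec⟩
  | impI _ ih => exact ⟨_, .impI ih.choose_spec⟩
  | impE hs _ _ ih₁ ih₂ => exact ⟨_, .impE hs ih₁.choose_spec ih₂.choose_spec⟩
  | conjI _ _ ih₁ ih₂ => exact ⟨_, .conjI ih₁.choose_spec ih₂.choose_spec⟩
  | conjE₁ hs _ _ ih₁ ih₂ => exact ⟨_, .conjE₁ hs ih₁.choose_spec ih₂.choose_spec⟩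
  | conjE₂ hs _ _ ih₁ ih₂ => exact ⟨_, .conjE₂ hs ih₁.choose_spec ih₂.choose_spec⟩
  | disjI₁ _ ih => exact ⟨_, .disjI₁ ih.choose_spec⟩
  | disjI₂ _ ih => exact ⟨_, .disjI₂ ih.choose_spec⟩
  | disjE hs _ _ _ ih₁ ih₂ ih₃ =>
    exact ⟨_, .disjE hs ih₁.choose_spec ih₂.choose_spec ih₃.choose_spec⟩

theorem Den.hasType {n : ℕ} {Γ : Ctx n} {t : Tm S n} {A : Proposition} {f : Env S n → Sem S A}
    (h : Den Γ t A f) : HasType Γ t A := by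
  induction h with
  | ax h₁ h₂ => exact .ax h₁ h₂
  | sum _ _ ih₁ ih₂ => exact .sum ih₁ ih₂
  | prod _ ih => exact .prod ih
  | topI h => exact .topI h
  | topE hs _ _ ih₁ ih₂ => exact .topE hs ih₁ ih₂
  | botE hs _ ih => exact .botE hs ih
  | impI _ ih => exact .impI ih
  | impE hs _ _ ih₁ ih₂ => exact .impE hs ih₁ ih₂
  | conjI _ _ ih₁ ih₂ => exact .conjI ih₁ ih₂
  | conjE₁ hs _ _ ih₁ ih₂ => exact .conjE₁ hs ih₁ ih₂
  | conjE₂ hs _ _ ih₁ ih₂ => exact .conjE₂ hs ih₁ ih₂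
  | disjI₁ _ ih => exact .disjI₁ ih
  | disjI₂ _ ih => exact .disjI₂ ih
  | disjE hs _ _ _ ih₁ ih₂ ih₃ => exact .disjE hs ih₁ ih₂ ih₃

/-! ### Linearity of denotations -/

/-- Two environments that agree on the variables declared in `Γ`. -/
def Agree {n : ℕ} (Γ : Ctx n) (e e' : Env S n) : Prop :=
  ∀ i A, Γ i = some A → e i A = e' i A

omit [Field S] in
theorem Agree.left {n : ℕ} {Γ Γ₁ Γ₂ : Ctx n} {e e' : Env S n} (h : Agree Γ e e')
    (hs : Γ.Splits Γ₁ Γ₂) : Agree Γ₁ e e' := fun i A hi => h i A (hs.left hi)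

omit [Field S] in
theorem Agree.right {n : ℕ} {Γ Γ₁ Γ₂ : Ctx n} {e e' : Env S n} (h : Agree Γ e e')
    (hs : Γ.Splits Γ₁ Γ₂) : Agree Γ₂ e e' := fun i A hi => h i A (hs.right hi)

theorem Agree.ext {n : ℕ} {Γ : Ctx n} {e e' : Env S n} (h : Agree Γ e e') {A : Proposition}
    (x : Sem S A) : Agree (Γ.ext A) (e.ext x) (e'.ext x) := by
  intro i B hi
  cases i using Fin.cases with
  | zero => rfl
  | succ i => exact h i B hi

theorem Den.congr {n : ℕ} {Γ : Ctx n} {t : Tm S n} {A : Proposition} {f : Env S n → Sem S A}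
    (h : Den Γ t A f) {e e' : Env S n} (he : Agree Γ e e') : f e = f e' := by
  induction h with
  | ax hi _ => exact he _ _ hi
  | sum _ _ ih₁ ih₂ => beta_reduce; rw [ih₁ he, ih₂ he]
  | prod _ ih => beta_reduce; rw [ih he]
  | topI h => rfl
  | topE hs _ _ ih₁ ih₂ => beta_reduce; rw [ih₁ (he.left hs), ih₂ (he.right hs)]
  | botE hs _ ih => rfl
  | impI _ ih => exact congrArg Sem.lam (funext fun x => ih (he.ext x))
  | impE hs _ _ ih₁ ih₂ => beta_reduce; rw [ih₁ (he.left hs), ih₂ (he.right hs)]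
  | conjI _ _ ih₁ ih₂ => beta_reduce; rw [ih₁ he, ih₂ he]
  | conjE₁ hs _ _ ih₁ ih₂ => beta_reduce; rw [ih₁ (he.left hs), ih₂ ((he.right hs).ext _)]
  | conjE₂ hs _ _ ih₁ ih₂ => beta_reduce; rw [ih₁ (he.left hs), ih₂ ((he.right hs).ext _)]
  | disjI₁ _ ih => beta_reduce; rw [ih he]
  | disjI₂ _ ih => beta_reduce; rw [ih he]
  | disjE hs _ _ _ ih₁ ih₂ ih₃ =>
    beta_reduce
    rw [ih₁ (he.left hs), ih₂ ((he.right hs).ext _), ih₃ ((he.right hs).ext _)]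

/-- The value of the variable `i` declared in `Γ` is in `e` the combination with coefficients
`a` and `b` of its values in `e₁` and `e₂`, while the other variables have the same values in the
three environments. -/
structure Comb {n : ℕ} (Γ : Ctx n) (i : Fin n) (a b : S) (e₁ e₂ e : Env S n) : Prop where
  declared : Γ i ≠ none
  eq_left : ∀ j A, Γ j = some A → j ≠ i → e j A = e₁ j A
  eq_right : ∀ j A, Γ j = some A → j ≠ i → e j A = e₂ j A
  eq_comb : ∀ A, Γ i = some A → e i A = a • e₁ i A + b • e₂ i A

/-- Linearity of contexts enters here: the varying variable belongs to exactly one part, and on the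
other part the three environments are indistinguishable. -/
theorem Comb.split {n : ℕ} {Γ Γ₁ Γ₂ : Ctx n} {i : Fin n} {a b : S} {e₁ e₂ e : Env S n}
    (h : Comb Γ i a b e₁ e₂ e) (hs : Γ.Splits Γ₁ Γ₂) :
    (Comb Γ₁ i a b e₁ e₂ e ∧ Agree Γ₂ e e₁ ∧ Agree Γ₂ e e₂) ∨
    (Comb Γ₂ i a b e₁ e₂ e ∧ Agree Γ₁ e e₁ ∧ Agree Γ₁ e e₂) := by
  have key : ∀ {Γ₁ Γ₂ : Ctx n}, Γ.Splits Γ₁ Γ₂ → Γ₁ i = Γ i → Γ₂ i = none →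
      Comb Γ₁ i a b e₁ e₂ e ∧ Agree Γ₂ e e₁ ∧ Agree Γ₂ e e₂ := by
    intro Γ₁ Γ₂ hs h₁ h₂
    have hne : ∀ j A, Γ₂ j = some A → j ≠ i := by
      rintro j A hj rfl
      simp_all
    exact ⟨⟨h₁ ▸ h.declared, fun j A hj => h.eq_left j A (hs.left hj),
      fun j A hj => h.eq_right j A (hs.left hj), fun A hA => h.eq_comb A (hs.left hA)⟩,
      fun j A hj => h.eq_left j A (hs.right hj) (hne j A hj),
      fun j A hj => h.eq_right j A (hs.right hj) (hne j A hj)⟩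
  rcases hs i with ⟨h₁, h₂⟩ | ⟨h₁, h₂⟩
  · exact .inl (key hs h₁ h₂)
  · exact .inr (key hs.symm h₂ h₁)

theorem Comb.ext {n : ℕ} {Γ : Ctx n} {i : Fin n} {a b : S} {e₁ e₂ e : Env S n}
    (h : Comb Γ i a b e₁ e₂ e) {A : Proposition} (x : Sem S A) :
    Comb (Γ.ext A) i.succ a b (e₁.ext x) (e₂.ext x) (e.ext x) where
  declared := h.declared
  eq_left := by
    intro j B hj hne
    cases j using Fin.cases with
    | zero => rfl
    | succ j => exact h.eq_left j B hj fun hji => hne (hji ▸ rfl)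
  eq_right := by
    intro j B hj hne
    cases j using Fin.cases with
    | zero => rfl
    | succ j => exact h.eq_right j B hj fun hji => hne (hji ▸ rfl)
  eq_comb := fun B hB => h.eq_comb B hB

/-- Moves a combination from the value of an eliminated term to the variable bound in a branch. -/
theorem Agree.comb {n : ℕ} {Γ : Ctx n} {e₁ e₂ e : Env S n} (h₁ : Agree Γ e e₁)
    (h₂ : Agree Γ e e₂) {A : Proposition} (a b : S) (x y : Sem S A) :
    Comb (Γ.ext A) 0 a b (e₁.ext x) (e₂.ext y) (e.ext (a • x + b • y)) where
  declared := by simp [Ctx.ext]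
  eq_left := by
    intro j B hj hne
    cases j using Fin.cases with
    | zero => exact (hne rfl).elim
    | succ j => exact h₁ j B hj
  eq_right := by
    intro j B hj hne
    cases j using Fin.cases with
    | zero => exact (hne rfl).elim
    | succ j => exact h₂ j B hj
  eq_comb := by
    intro B hB
    obtain rfl : A = B := Option.some.inj hB
    simp only [Env.ext_zero]

/-- In additive rules every premise varies and the results add up. In multiplicative rules only one
premise varies, and the rule is bilinear. For eliminations with a bound variable, the variation
either reaches the branch directly or passes through the bound variable. -/
theorem Den.map_comb {n : ℕ} {Γ : Ctx n} {t : Tm S n} {A : Proposition} {f : Env S n → Sem S A}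
    (h : Den Γ t A f) {i : Fin n} {a b : S} {e₁ e₂ e : Env S n} (he : Comb Γ i a b e₁ e₂ e) :
    f e = a • f e₁ + b • f e₂ := by
  induction h with
  | @ax _ _ j _ hj hne =>
    have : i = j := by
      by_contra hij
      exact he.declared (hne i hij)
    subst this
    exact he.eq_comb _ hj
  | sum _ _ ih₁ ih₂ => beta_reduce; rw [ih₁ he, ih₂ he]; module
  | prod _ ih => beta_reduce; rw [ih he]; module
  | topI h => exact (he.declared (h i)).elim
  | topE hs h₁ h₂ ih₁ ih₂ =>
    beta_reduce
    rcases he.split hs with ⟨hc, k₁, k₂⟩ | ⟨hc, k₁, k₂⟩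
    · rw [ih₁ hc, ← h₂.congr k₁, ← h₂.congr k₂]
      change (a * _ + b * _) • _ = _
      simp only [Sem.coord]
      module
    · rw [ih₂ hc, ← h₁.congr k₁, ← h₁.congr k₂]
      module
  | botE hs _ ih => simp
  | impI _ ih =>
    classical
    funext p
    -- A matrix entry is a coordinate of the body at a basis vector, which stays fixed while `i`
    -- varies.
    exact congrFun (ih (he.ext (Pi.single p.1 1))) p.2
  | impE hs h₁ h₂ ih₁ ih₂ =>
    beta_reduce
    rcases he.split hs with ⟨hc, k₁, k₂⟩ | ⟨hc, k₁, k₂⟩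
    · rw [ih₁ hc, ← h₂.congr k₁, ← h₂.congr k₂, Sem.app_combination_left]
    · rw [ih₂ hc, ← h₁.congr k₁, ← h₁.congr k₂, Sem.app_combination_right]
  | conjI _ _ ih₁ ih₂ =>
    beta_reduce
    rw [ih₁ he, ih₂ he]
    funext p
    rcases p with p | p <;> rfl
  | conjE₁ hs h₁ h₂ ih₁ ih₂ =>
    beta_reduce
    rcases he.split hs with ⟨hc, k₁, k₂⟩ | ⟨hc, k₁, k₂⟩
    · rw [ih₁ hc]
      exact ih₂ (k₁.comb k₂ a b _ _)
    · rw [← h₁.congr k₁, ← h₁.congr k₂]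
      exact ih₂ (hc.ext _)
  | conjE₂ hs h₁ h₂ ih₁ ih₂ =>
    beta_reduce
    rcases he.split hs with ⟨hc, k₁, k₂⟩ | ⟨hc, k₁, k₂⟩
    · rw [ih₁ hc]
      exact ih₂ (k₁.comb k₂ a b _ _)
    · rw [← h₁.congr k₁, ← h₁.congr k₂]
      exact ih₂ (hc.ext _)
  | disjI₁ _ ih =>
    beta_reduce
    rw [ih he]
    funext p
    rcases p with p | p
    · rfl
    · change (0 : S) = a • 0 + b • 0
      simp
  | disjI₂ _ ih =>
    beta_reduce
    rw [ih he]
    funext p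
    rcases p with p | p
    · change (0 : S) = a • 0 + b • 0
      simp
    · rfl
  | @disjE _ _ _ _ _ _ _ _ _ C f g h hs h₁ h₂ h₃ ih₁ ih₂ ih₃ =>
    have key : ∀ x₁ x₂ y₁ y₂ : Sem S C, a • x₁ + b • x₂ + (a • y₁ + b • y₂) =
        a • (x₁ + y₁) + b • (x₂ + y₂) := fun _ _ _ _ => by module
    beta_reduce
    rcases he.split hs with ⟨hc, k₁, k₂⟩ | ⟨hc, k₁, k₂⟩
    · rw [ih₁ hc]
      exact (congrArg₂ (· + ·) (ih₂ (k₁.comb k₂ a b (f e₁).left (f e₂).left))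
        (ih₃ (k₁.comb k₂ a b (f e₁).right (f e₂).right))).trans (key _ _ _ _)
    · rw [← h₁.congr k₁, ← h₁.congr k₂]
      exact (congrArg₂ (· + ·) (ih₂ (hc.ext _)) (ih₃ (hc.ext _))).trans (key _ _ _ _)

theorem Den.isLinearMap {n : ℕ} {Γ : Ctx n} {t : Tm S (n + 1)} {A B : Proposition}
    {f : Env S (n + 1) → Sem S B} (h : Den (Γ.ext A) t B f) (e : Env S n) :
    IsLinearMap S fun x : Sem S A => f (e.ext x) where
  map_add x y := by
    have := h.map_comb (Agree.comb (e := e) (fun _ _ _ => rfl) (fun _ _ _ => rfl) 1 1 x y)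
    simpa only [one_smul] using this
  map_smul c x := by
    have := h.map_comb (Agree.comb (e := e) (fun _ _ _ => rfl) (fun _ _ _ => rfl) c 0 x 0)
    simpa only [zero_smul, add_zero] using this

/-! ### Substitution and subject reduction -/

theorem Den.of_eq {n : ℕ} {Γ : Ctx n} {t : Tm S n} {A : Proposition} {f g : Env S n → Sem S A}
    (h : Den Γ t A f) (hfg : ∀ e, g e = f e) : Den Γ t A g :=
  (funext hfg : g = f) ▸ h

/-- `Δ` is the image of the context `Γ` by the injective renaming `ρ`. -/
structure Ctx.Image {m n : ℕ} (ρ : Fin m → Fin n) (Γ : Ctx m) (Δ : Ctx n) : Prop where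
  injective : Function.Injective ρ
  apply_eq : ∀ i, Δ (ρ i) = Γ i
  eq_none : ∀ j, (∀ i, ρ i ≠ j) → Δ j = none

theorem Ctx.Image.ext {m n : ℕ} {ρ : Fin m → Fin n} {Γ : Ctx m} {Δ : Ctx n}
    (h : Ctx.Image ρ Γ Δ) (A : Proposition) :
    Ctx.Image (Tm.upRen ρ) (Γ.ext A) (Δ.ext A) where
  injective := by
    intro i j hij
    cases i using Fin.cases with
    | zero =>
      cases j using Fin.cases with
      | zero => rfl
      | succ j => exact (Fin.succ_ne_zero _ hij.symm).elim
    | succ i =>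
      cases j using Fin.cases with
      | zero => exact (Fin.succ_ne_zero _ hij).elim
      | succ j => exact congrArg Fin.succ (h.injective (Fin.succ_injective _ hij))
  apply_eq := by
    intro i
    cases i using Fin.cases with
    | zero => rfl
    | succ i => exact h.apply_eq i
  eq_none := by
    intro j hj
    cases j using Fin.cases with
    | zero => exact (hj 0 rfl).elim
    | succ j => exact h.eq_none j fun i hi => hj i.succ (congrArg Fin.succ hi)

/-- Each part is transported along `ρ` and left undeclared off the image of `ρ`, as linear typing
forbids superfluous variables. -/
theorem Ctx.Image.split {m n : ℕ} {ρ : Fin m → Fin n} {Γ Γ₁ Γ₂ : Ctx m} {Δ : Ctx n}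
    (h : Ctx.Image ρ Γ Δ) (hs : Γ.Splits Γ₁ Γ₂) :
    ∃ Δ₁ Δ₂, Δ.Splits Δ₁ Δ₂ ∧ Ctx.Image ρ Γ₁ Δ₁ ∧ Ctx.Image ρ Γ₂ Δ₂ := by
  have key : ∀ Γ' : Ctx m, Ctx.Image ρ Γ' (Function.extend ρ Γ' fun _ => none) := fun Γ' =>
    ⟨h.injective, fun i => h.injective.extend_apply _ _ i,
      fun j hj => Function.extend_apply' _ _ j fun ⟨i, hi⟩ => hj i hi⟩
  refine ⟨_, _, fun j => ?_, key Γ₁, key Γ₂⟩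
  by_cases hj : ∃ i, ρ i = j
  · obtain ⟨i, rfl⟩ := hj
    simp only [h.injective.extend_apply, h.apply_eq]
    exact hs i
  · left
    rw [Function.extend_apply' _ _ j hj, Function.extend_apply' _ _ j hj,
      h.eq_none j fun i hi => hj ⟨i, hi⟩]
    exact ⟨rfl, rfl⟩

theorem Env.ext_comp_upRen {m n : ℕ} (ρ : Fin m → Fin n) (e : Env S n) {A : Proposition}
    (x : Sem S A) : (fun i => e.ext x (Tm.upRen ρ i)) = Env.ext (fun i => e (ρ i)) x := by
  funext i
  cases i using Fin.cases <;> rfl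

theorem Den.rename {m n : ℕ} {Γ : Ctx m} {t : Tm S m} {A : Proposition} {f : Env S m → Sem S A}
    (h : Den Γ t A f) {ρ : Fin m → Fin n} {Δ : Ctx n} (hρ : Ctx.Image ρ Γ Δ) :
    Den Δ (t.rename ρ) A (fun e => f fun i => e (ρ i)) := by
  induction h generalizing n with
  | ax hi hne =>
    refine .ax ((hρ.apply_eq _).trans hi) fun j hj => ?_
    by_cases h : ∃ i, ρ i = j
    · obtain ⟨i, rfl⟩ := h
      exact (hρ.apply_eq i).trans (hne i fun hij => hj (hij ▸ rfl))
    · exact hρ.eq_none j fun i hi => h ⟨i, hi⟩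
  | sum _ _ ih₁ ih₂ => exact .sum (ih₁ hρ) (ih₂ hρ)
  | prod _ ih => exact .prod (ih hρ)
  | topI h =>
    refine .topI fun j => ?_
    by_cases h' : ∃ i, ρ i = j
    · obtain ⟨i, rfl⟩ := h'
      exact (hρ.apply_eq i).trans (h i)
    · exact hρ.eq_none j fun i hi => h' ⟨i, hi⟩
  | topE hs _ _ ih₁ ih₂ =>
    obtain ⟨Δ₁, Δ₂, hs', k₁, k₂⟩ := hρ.split hs
    exact .topE hs' (ih₁ k₁) (ih₂ k₂)
  | botE hs _ ih =>
    obtain ⟨Δ₁, Δ₂, hs', k₁, k₂⟩ := hρ.split hs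
    exact .botE hs' (ih k₁)
  | impI _ ih =>
    refine (Den.impI (ih (hρ.ext _))).of_eq fun e => ?_
    simp only [Env.ext_comp_upRen]
  | impE hs _ _ ih₁ ih₂ =>
    obtain ⟨Δ₁, Δ₂, hs', k₁, k₂⟩ := hρ.split hs
    exact .impE hs' (ih₁ k₁) (ih₂ k₂)
  | conjI _ _ ih₁ ih₂ => exact .conjI (ih₁ hρ) (ih₂ hρ)
  | conjE₁ hs _ _ ih₁ ih₂ =>
    obtain ⟨Δ₁, Δ₂, hs', k₁, k₂⟩ := hρ.split hs
    refine (Den.conjE₁ hs' (ih₁ k₁) (ih₂ (k₂.ext _))).of_eq fun e => ?_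
    simp only [Env.ext_comp_upRen]
  | conjE₂ hs _ _ ih₁ ih₂ =>
    obtain ⟨Δ₁, Δ₂, hs', k₁, k₂⟩ := hρ.split hs
    refine (Den.conjE₂ hs' (ih₁ k₁) (ih₂ (k₂.ext _))).of_eq fun e => ?_
    simp only [Env.ext_comp_upRen]
  | disjI₁ _ ih => exact .disjI₁ (ih hρ)
  | disjI₂ _ ih => exact .disjI₂ (ih hρ)
  | disjE hs _ _ _ ih₁ ih₂ ih₃ =>
    obtain ⟨Δ₁, Δ₂, hs', k₁, k₂⟩ := hρ.split hs
    refine (Den.disjE hs' (ih₁ k₁) (ih₂ (k₂.ext _)) (ih₃ (k₂.ext _))).of_eq fun e => ?_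
    simp only [Env.ext_comp_upRen]

/-- The part of the context `Δ` that the ownership function `o` attributes to `i`. -/
def Ctx.part {m n : ℕ} (Δ : Ctx n) (o : Fin n → Fin m) (i : Fin m) : Ctx n :=
  fun j => if o j = i then Δ j else none

/-- The substitution `σ`, with denotation `Φ`, takes the variables declared in `Γ` to terms whose
contexts, given by the ownership function `o`, have the disjoint union `Δ`. -/
structure DenSubst {m n : ℕ} (Γ : Ctx m) (Δ : Ctx n) (o : Fin n → Fin m) (σ : Fin m → Tm S n)
    (Φ : Env S n → Env S m) : Prop where
  eq_none : ∀ j, Γ (o j) = none → Δ j = none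
  den : ∀ i A, Γ i = some A → Den (Δ.part o i) (σ i) A (fun e => Φ e i A)

/-- One ownership function serves both parts: a variable of `Δ` follows its owner. If the owner is
undeclared in `Γ`, the variable is undeclared in `Δ`, so nothing has to be placed. -/
theorem DenSubst.split {m n : ℕ} {Γ Γ₁ Γ₂ : Ctx m} {Δ : Ctx n} {o : Fin n → Fin m}
    {σ : Fin m → Tm S n} {Φ : Env S n → Env S m} (h : DenSubst Γ Δ o σ Φ)
    (hs : Γ.Splits Γ₁ Γ₂) :
    ∃ Δ₁ Δ₂, Δ.Splits Δ₁ Δ₂ ∧ DenSubst Γ₁ Δ₁ o σ Φ ∧ DenSubst Γ₂ Δ₂ o σ Φ := by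
  have key : ∀ Γ' : Ctx m, (∀ i A, Γ' i = some A → Γ i = some A) →
      DenSubst Γ' (fun j => if Γ' (o j) = none then none else Δ j) o σ Φ := by
    intro Γ' h'
    refine ⟨fun j hj => if_pos hj, fun i A hi => ?_⟩
    convert h.den i A (h' i A hi) using 1
    funext j
    simp only [Ctx.part]
    split_ifs with h₁ h₂
    · simp_all
    · rfl
    · rfl
  refine ⟨_, _, fun j => ?_, key Γ₁ fun i A => hs.left, key Γ₂ fun i A => hs.right⟩
  have h₀ := h.eq_none j
  rcases hs (o j) with ⟨h₁, h₂⟩ | ⟨h₁, h₂⟩ <;> by_cases h₃ : Γ (o j) = none <;> simp_all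

theorem DenSubst.ext {m n : ℕ} {Γ : Ctx m} {Δ : Ctx n} {o : Fin n → Fin m}
    {σ : Fin m → Tm S n} {Φ : Env S n → Env S m} (h : DenSubst Γ Δ o σ Φ) (A : Proposition) :
    DenSubst (Γ.ext A) (Δ.ext A) (Tm.upRen o) (Tm.upSubst σ)
      (fun e => Fin.cons (e 0) (Φ fun i => e i.succ)) where
  eq_none := by
    intro j hj
    cases j using Fin.cases with
    | zero => cases hj
    | succ j => exact h.eq_none j hj
  den := by
    intro i B hi
    cases i using Fin.cases with
    | zero =>
      refine Den.ax ((if_pos rfl).trans hi) fun j hj => ?_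
      cases j using Fin.cases with
      | zero => exact (hj rfl).elim
      | succ j => exact if_neg (Fin.succ_ne_zero _)
    | succ i =>
      refine (h.den i B hi).rename ⟨Fin.succ_injective _, fun j => ?_, fun j hj => ?_⟩
      · simp only [Ctx.part, Tm.upRen, Fin.cases_succ, Fin.succ_inj]
        rfl
      · cases j using Fin.cases with
        | zero => exact if_neg (Fin.succ_ne_zero _).symm
        | succ j => exact (hj j rfl).elim

/-- Substitution is composition of denotations. Ownership ensures that the contexts of the
substituted terms remain disjoint. -/
theorem Den.subst {m n : ℕ} {Γ : Ctx m} {t : Tm S m} {A : Proposition} {f : Env S m → Sem S A}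
    (h : Den Γ t A f) {Δ : Ctx n} {o : Fin n → Fin m} {σ : Fin m → Tm S n}
    {Φ : Env S n → Env S m} (hσ : DenSubst Γ Δ o σ Φ) :
    Den Δ (t.subst σ) A (fun e => f (Φ e)) := by
  induction h generalizing n with
  | @ax _ _ i _ hi hne =>
    change Den Δ (σ i) _ _
    convert hσ.den _ _ hi using 1
    funext j
    simp only [Ctx.part]
    split_ifs with hj
    · rfl
    · exact hσ.eq_none j (hne _ hj)
  | sum _ _ ih₁ ih₂ => exact .sum (ih₁ hσ) (ih₂ hσ)
  | prod _ ih => exact .prod (ih hσ)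
  | topI h => exact .topI fun j => hσ.eq_none j (h _)
  | topE hs _ _ ih₁ ih₂ =>
    obtain ⟨Δ₁, Δ₂, hs', k₁, k₂⟩ := hσ.split hs
    exact .topE hs' (ih₁ k₁) (ih₂ k₂)
  | botE hs _ ih =>
    obtain ⟨Δ₁, Δ₂, hs', k₁, k₂⟩ := hσ.split hs
    exact .botE hs' (ih k₁)
  | impI _ ih => exact .impI (ih (hσ.ext _))
  | impE hs _ _ ih₁ ih₂ =>
    obtain ⟨Δ₁, Δ₂, hs', k₁, k₂⟩ := hσ.split hs
    exact .impE hs' (ih₁ k₁) (ih₂ k₂)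
  | conjI _ _ ih₁ ih₂ => exact .conjI (ih₁ hσ) (ih₂ hσ)
  | conjE₁ hs _ _ ih₁ ih₂ =>
    obtain ⟨Δ₁, Δ₂, hs', k₁, k₂⟩ := hσ.split hs
    exact .conjE₁ hs' (ih₁ k₁) (ih₂ (k₂.ext _))
  | conjE₂ hs _ _ ih₁ ih₂ =>
    obtain ⟨Δ₁, Δ₂, hs', k₁, k₂⟩ := hσ.split hs
    exact .conjE₂ hs' (ih₁ k₁) (ih₂ (k₂.ext _))
  | disjI₁ _ ih => exact .disjI₁ (ih hσ)
  | disjI₂ _ ih => exact .disjI₂ (ih hσ)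
  | disjE hs _ _ _ ih₁ ih₂ ih₃ =>
    obtain ⟨Δ₁, Δ₂, hs', k₁, k₂⟩ := hσ.split hs
    exact .disjE hs' (ih₁ k₁) (ih₂ (k₂.ext _)) (ih₃ (k₂.ext _))

theorem Den.inst {n : ℕ} {Γ Γ₁ Γ₂ : Ctx n} {t : Tm S (n + 1)} {u : Tm S n} {A B : Proposition}
    {f : Env S n → Sem S A} {g : Env S (n + 1) → Sem S B} (ht : Den (Γ₂.ext A) t B g)
    (hs : Γ.Splits Γ₁ Γ₂) (hu : Den Γ₁ u A f) :
    Den Γ (t.inst u) B (fun e => g (e.ext (f e))) := by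
  -- Variables declared in `Γ₁` are owned by variable `0`, which `u` replaces; every other variable
  -- is owned by its own shift.
  refine ht.subst (o := fun j => if Γ₁ j = none then j.succ else 0) (Φ := fun e => e.ext (f e))
    ⟨fun j hj => ?_, fun i C hi => ?_⟩
  · rcases hs j with ⟨h₁, h₂⟩ | ⟨h₁, h₂⟩
    · by_cases h : Γ₁ j = none
      · exact h₁ ▸ h
      · rw [if_neg h] at hj
        cases hj
    · rw [if_pos h₁] at hj
      exact h₂ ▸ hj
  · cases i using Fin.cases with
    | zero =>
      obtain rfl : A = C := Option.some.inj hi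
      simp only [Env.ext_zero]
      change Den _ u _ _
      convert hu using 1
      funext j
      simp only [Ctx.part]
      rcases hs j with ⟨h₁, h₂⟩ | ⟨h₁, h₂⟩ <;> by_cases h : Γ₁ j = none <;> simp_all
    | succ i =>
      have hi' : Γ₂ i = some C := hi
      refine Den.ax ?_ fun j hj => ?_
      · rcases hs i with ⟨h₁, h₂⟩ | ⟨h₁, h₂⟩ <;> simp_all [Ctx.part]
      · by_cases h : Γ₁ j = none
        · simp [Ctx.part, h, hj]
        · simp [Ctx.part, h, (Fin.succ_ne_zero i).symm]

theorem Ctx.Splits.right_eq {n : ℕ} {Γ Γ₁ Γ₂ : Ctx n} (h : Γ.Splits Γ₁ Γ₂)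
    (h₁ : ∀ j, Γ₁ j = none) : Γ₂ = Γ := by
  funext j
  rcases h j with ⟨k₁, k₂⟩ | ⟨_, k₂⟩
  · rw [k₂, ← k₁, h₁]
  · exact k₂

/-- Subject reduction with the same function `f`, for whichever derivation is given. -/
theorem Den.step {n : ℕ} {t t' : Tm S n} (hst : Step t t') {Γ : Ctx n} {A : Proposition}
    {f : Env S n → Sem S A} (h : Den Γ t A f) : Den Γ t' A f := by
  induction hst generalizing A with
  | topBeta a t =>
    cases h with
    | topE hs h₁ h₂ =>
      cases h₁ with
      | topI h₀ => exact .prod (hs.right_eq h₀ ▸ h₂)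
  | beta t u =>
    cases h with
    | impE hs h₁ h₂ =>
      cases h₁ with
      | impI h₁ => exact (h₁.inst hs.symm h₂).of_eq fun e => Sem.app_lam (h₁.isLinearMap e) _
  | conjBeta₁ t u v =>
    cases h with
    | conjE₁ hs h₁ h₂ =>
      cases h₁ with
      | conjI h₁ _ => exact h₂.inst hs h₁
  | conjBeta₂ t u v =>
    cases h with
    | conjE₂ hs h₁ h₂ =>
      cases h₁ with
      | conjI _ h₁ => exact h₂.inst hs h₁
  | disjBeta₁ t v w =>
    cases h with
    | disjE hs h₁ h₂ h₃ =>
      cases h₁ with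
      | disjI₁ h₁ =>
        -- The other branch is evaluated at `0` and vanishes by linearity.
        exact (h₂.inst hs h₁).of_eq fun e =>
          (congrArg _ (h₃.isLinearMap e).mk'.map_zero).trans (add_zero _)
  | disjBeta₂ u v w =>
    cases h with
    | disjE hs h₁ h₂ h₃ =>
      cases h₁ with
      | disjI₂ h₁ =>
        exact (h₃.inst hs h₁).of_eq fun e =>
          (congrArg (· + _) (h₂.isLinearMap e).mk'.map_zero).trans (zero_add _)
  | plusStar a b =>
    cases h with
    | sum h₁ h₂ =>
      cases h₁ with
      | topI h₀ =>
        cases h₂ with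
        | topI _ => exact .topI h₀
  | plusLam t u =>
    cases h with
    | sum h₁ h₂ =>
      cases h₁ with
      | impI h₁ =>
        cases h₂ with
        | impI h₂ => exact .impI (.sum h₁ h₂)
  | plusPair t u v w =>
    cases h with
    | sum h₁ h₂ =>
      cases h₁ with
      | conjI h₁ k₁ =>
        cases h₂ with
        | conjI h₂ k₂ =>
          refine (Den.conjI (.sum h₁ h₂) (.sum k₁ k₂)).of_eq fun e => ?_
          funext p
          rcases p with p | p <;> rfl
  | disjPlus t u v w =>
    cases h with
    | disjE hs h₁ h₂ h₃ =>
      cases h₁ with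
      | sum k₁ k₂ =>
        -- Both branches are additive in their bound variable.
        refine (Den.sum (.disjE hs k₁ h₂ h₃) (.disjE hs k₂ h₂ h₃)).of_eq fun e => ?_
        refine (congrArg₂ (· + ·) ((h₂.isLinearMap e).map_add _ _)
          ((h₃.isLinearMap e).map_add _ _)).trans ?_
        exact add_add_add_comm _ _ _ _
  | scalStar a b =>
    cases h with
    | prod h =>
      cases h with
      | topI h₀ => exact .topI h₀
  | scalLam a t =>
    cases h with
    | prod h =>
      cases h with
      | impI h => exact .impI (.prod h)
  | scalPair a t u =>
    cases h with
    | prod h =>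
      cases h with
      | conjI h₁ h₂ =>
        refine (Den.conjI (.prod h₁) (.prod h₂)).of_eq fun e => ?_
        funext p
        rcases p with p | p <;> rfl
  | disjScal a t v w =>
    cases h with
    | disjE hs h₁ h₂ h₃ =>
      cases h₁ with
      | prod h₁ =>
        refine (Den.prod (.disjE hs h₁ h₂ h₃)).of_eq fun e => ?_
        refine (congrArg₂ (· + ·) ((h₂.isLinearMap e).map_smul _ _)
          ((h₃.isLinearMap e).map_smul _ _)).trans ?_
        exact (smul_add _ _ _).symm
  | plusL u _ ih => cases h with | sum h₁ h₂ => exact .sum (ih h₁) h₂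
  | plusR t _ ih => cases h with | sum h₁ h₂ => exact .sum h₁ (ih h₂)
  | scalC a _ ih => cases h with | prod h => exact .prod (ih h)
  | elimTopL u _ ih => cases h with | topE hs h₁ h₂ => exact .topE hs (ih h₁) h₂
  | elimTopR t _ ih => cases h with | topE hs h₁ h₂ => exact .topE hs h₁ (ih h₂)
  | elimBotC _ ih => cases h with | botE hs h => exact .botE hs (ih h)
  | lamC _ ih => cases h with | impI h => exact .impI (ih h)
  | appL u _ ih => cases h with | impE hs h₁ h₂ => exact .impE hs (ih h₁) h₂
  | appR t _ ih => cases h with | impE hs h₁ h₂ => exact .impE hs h₁ (ih h₂)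
  | pairL u _ ih => cases h with | conjI h₁ h₂ => exact .conjI (ih h₁) h₂
  | pairR t _ ih => cases h with | conjI h₁ h₂ => exact .conjI h₁ (ih h₂)
  | elimConj₁L u _ ih => cases h with | conjE₁ hs h₁ h₂ => exact .conjE₁ hs (ih h₁) h₂
  | elimConj₁R t _ ih => cases h with | conjE₁ hs h₁ h₂ => exact .conjE₁ hs h₁ (ih h₂)
  | elimConj₂L u _ ih => cases h with | conjE₂ hs h₁ h₂ => exact .conjE₂ hs (ih h₁) h₂
  | elimConj₂R t _ ih => cases h with | conjE₂ hs h₁ h₂ => exact .conjE₂ hs h₁ (ih h₂)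
  | inlC _ ih => cases h with | disjI₁ h => exact .disjI₁ (ih h)
  | inrC _ ih => cases h with | disjI₂ h => exact .disjI₂ (ih h)
  | elimDisjL u v _ ih => cases h with | disjE hs h₁ h₂ h₃ => exact .disjE hs (ih h₁) h₂ h₃
  | elimDisjM t v _ ih => cases h with | disjE hs h₁ h₂ h₃ => exact .disjE hs h₁ (ih h₂) h₃
  | elimDisjR t u _ ih => cases h with | disjE hs h₁ h₂ h₃ => exact .disjE hs h₁ h₂ (ih h₃)

theorem Den.steps {n : ℕ} {t t' : Tm S n} (hst : ReflTransGen Step t t') {Γ : Ctx n}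
    {A : Proposition} {f : Env S n → Sem S A} (h : Den Γ t A f) : Den Γ t' A f := by
  induction hst with
  | refl => exact h
  | tail _ hst ih => exact ih.step hst

/-! ### Vectors -/

/-- The coordinates of a proposition of `𝒱` index the basis of its interpretation. -/
def VProp.idxEquiv : (A : VProp) → Fin A.dim ≃ Idx A.toProposition
  | .top => (finOneEquiv : Fin 1 ≃ Unit)
  | .conj A B => finSumFinEquiv.symm.trans (Equiv.sumCongr A.idxEquiv B.idxEquiv)

/-- Every denotation of an encoding, from whatever derivation, has the encoded coordinates.
Preserved denotations therefore determine irreducible forms. -/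
theorem Den.encode_apply {Γ : Ctx 0} {A : VProp} {x : Fin A.dim → S}
    {f : Env S 0 → Sem S A.toProposition} (h : Den Γ (encode A x) A.toProposition f)
    (e : Env S 0) (i : Fin A.dim) : f e (A.idxEquiv i) = x i := by
  induction A with
  | top =>
    change Den _ (Tm.star _) Proposition.top _ at h
    cases h with
    | topI _ => exact congrArg x (Subsingleton.elim (α := Fin 1) _ _)
  | conj A B ihA ihB =>
    change Den _ (Tm.pair _ _) (Proposition.conj _ _) _ at h
    cases h with
    | conjI h₁ h₂ =>
      revert i
      refine Fin.addCases (fun i => ?_) (fun i => ?_)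
      · refine Eq.trans ?_ (ihA h₁ i)
        exact congrArg (fun p => Sem.pair _ _ (Equiv.sumCongr A.idxEquiv B.idxEquiv p))
          (finSumFinEquiv_symm_apply_castAdd i)
      · refine Eq.trans ?_ (ihB h₂ i)
        exact congrArg (fun p => Sem.pair _ _ (Equiv.sumCongr A.idxEquiv B.idxEquiv p))
          (finSumFinEquiv_symm_apply_natAdd i)

omit [Field S] in
theorem isClosedProof_encode (A : VProp) (x : Fin A.dim → S) :
    IsClosedProof (encode A x) A.toProposition := by
  induction A with
  | top => exact .topI fun _ => rfl
  | conj A B ihA ihB => exact .conjI (ihA _) (ihB _)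

omit [Field S] in
theorem IsClosedProof.app {t u : Tm S 0} {A B : Proposition} (ht : IsClosedProof t (.imp A B))
    (hu : IsClosedProof u A) : IsClosedProof (.app t u) B :=
  .impE (fun i => i.elim0) ht hu

theorem Den.isNormalFormOf_iff {A : VProp} {t : Tm S 0} {f : Env S 0 → Sem S A.toProposition}
    (h : Den (fun _ => none) t A.toProposition f) (e : Env S 0) (v : Tm S 0) :
    IsNormalFormOf v t ↔ v = encode A (fun i => f e (A.idxEquiv i)) := by
  have key : ∀ v, IsNormalFormOf v t → v = encode A (fun i => f e (A.idxEquiv i)) := by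
    rintro v ⟨htv, hv⟩
    have hd := h.steps htv
    obtain ⟨x, hx⟩ := (IsClosedProof.red hd.hasType).exists_encode
    obtain rfl := eq_of_reflTransGen_of_irreducible hx hv
    exact congrArg _ (funext fun i => (hd.encode_apply e i).symm)
  refine ⟨key v, ?_⟩
  rintro rfl
  obtain ⟨x, hx⟩ := (IsClosedProof.red h.hasType).exists_encode
  have hn : IsNormalFormOf (encode A x) t := ⟨hx, not_step_encode A x⟩
  -- Normalization supplies some encoding, and uniqueness identifies it with the claimed one.
  exact key _ hn ▸ hn

theorem Den.vectorOf_eq {A : VProp} {t : Tm S 0} {f : Env S 0 → Sem S A.toProposition}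
    (h : Den (fun _ => none) t A.toProposition f) (e : Env S 0) :
    vectorOf A t = fun i => f e (A.idxEquiv i) := by
  have hex : ∃ v, IsNormalFormOf v t := ⟨_, (h.isNormalFormOf_iff e _).2 rfl⟩
  have hn : normalForm t = encode A (fun i => f e (A.idxEquiv i)) := by
    rw [normalForm, dif_pos hex]
    exact (h.isNormalFormOf_iff e _).1 hex.choose_spec
  rw [vectorOf, hn, decode_encode]

theorem isNormalFormOf_iff_eq_encode_vectorOf {A : VProp} {t : Tm S 0}
    (h : IsClosedProof t A.toProposition) (v : Tm S 0) :
    IsNormalFormOf v t ↔ v = encode A (vectorOf A t) := by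
  obtain ⟨f, hf⟩ := HasType.exists_den h
  rw [hf.vectorOf_eq 0]
  exact hf.isNormalFormOf_iff 0 v

theorem IsClosedProof.isLinearMap_applyVec {A B : VProp} {t : Tm S 0}
    (h : IsClosedProof t (.imp A.toProposition B.toProposition)) :
    IsLinearMap S (applyVec A B t) := by
  obtain ⟨f, hf⟩ := HasType.exists_den h
  -- The matrix `f 0` is chosen before `x`, so a single matrix serves all vectors; with no
  -- variables, the environment `0` is immaterial.
  have key : ∀ x, applyVec A B t x =
      fun i => Sem.app (f 0) (fun j => x (A.idxEquiv.symm j)) (B.idxEquiv i) := by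
    intro x
    obtain ⟨g, hg⟩ := HasType.exists_den (isClosedProof_encode A x)
    have hgx : g 0 = fun j => x (A.idxEquiv.symm j) := by
      funext j
      rw [← hg.encode_apply 0, Equiv.apply_symm_apply]
    have happ : Den (fun _ => none) (.app t (encode A x)) B.toProposition
      (fun e => Sem.app (f e) (g e)) := .impE (fun i => i.elim0) hf hg
    rw [applyVec, happ.vectorOf_eq 0, hgx]
  have hcomb : ∀ (a b : S) (x y : Fin A.dim → S), applyVec A B t (a • x + b • y) =
      a • applyVec A B t x + b • applyVec A B t y := by
    intro a b x y
    rw [key, key, key]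
    funext i
    exact congrFun (Sem.app_combination_right a b (f 0) (fun j => x (A.idxEquiv.symm j))
      fun j => y (A.idxEquiv.symm j)) (B.idxEquiv i)
  constructor
  · intro x y
    simpa only [one_smul] using hcomb 1 1 x y
  · intro c x
    simpa only [zero_smul, add_zero] using hcomb c 0 x 0

end Semantics

end LS

/-! ### Linearity of expressible functions and no-cloning -/

theorem mainTheorem2 {S : Type*} [Field S] :
    (∀ (A B : LS.VProp) (t : LS.Tm S 0),
      LS.IsClosedProof t (.imp A.toProposition B.toProposition) →
        (∀ (x : Fin A.dim → S) (v : LS.Tm S 0),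
          LS.IsNormalFormOf v (.app t (LS.encode A x)) ↔
            v = LS.encode B (LS.applyVec A B t x)) ∧
        IsLinearMap S (LS.applyVec A B t)) ∧
    ¬ ∃ t : LS.Tm S 0,
      LS.IsClosedProof t
        (.imp (.conj .top .top) (.conj (.conj .top .top) (.conj .top .top))) ∧
      ∀ a b : S,
        LS.applyVec (.conj .top .top) (.conj (.conj .top .top) (.conj .top .top)) t
            (![a, b] : Fin 2 → S) =
          (![a ^ 2, a * b, a * b, b ^ 2] : Fin 4 → S) := by
  
  refine ⟨fun A B t ht => ⟨fun x v => ?_, ht.isLinearMap_applyVec⟩, ?_⟩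
  · exact LS.isNormalFormOf_iff_eq_encode_vectorOf (ht.app (LS.isClosedProof_encode A x)) v
  · rintro ⟨t, ht, hclone⟩
    have hlin := LS.IsClosedProof.isLinearMap_applyVec (A := .conj .top .top)
      (B := .conj (.conj .top .top) (.conj .top .top)) ht
    have hadd := hlin.map_add (![1, 0] : Fin 2 → S) (![0, 1] : Fin 2 → S)
    have hsum : (![1, 0] + ![0, 1] : Fin 2 → S) = ![1, 1] := by
      funext i
      fin_cases i <;> simp
    have hadd' := (congrArg (LS.applyVec _ _ t) hsum).symm.trans hadd
    rw [hclone, hclone, hclone] at hadd'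
    -- The coordinate `ab` is compared because `a ^ 2` is additive in characteristic two.
    have h : (1 : S) * 1 = 1 * 0 + 0 * 1 := congrFun hadd' (1 : Fin 4)
    simp at h
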